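/- Let $M$ be a 4-dimensional space-time and work over the domain $U\subset\mathbb R^4$ of natural coordinates $(x^\mu)$ of $M$ in which the volume form is $\mathrm d^4x$; repeated indices are summed over $0,\dots,3$, and $\mathrm d^3x_\mu=i(\partial/\partial x^\mu)\mathrm d^4x$. Let $E=\Sigma\times_M C(LM)$ have coordinates $(x^\mu,g_{\alpha\beta},\Gamma^\alpha_{\beta\gamma})$, where $g$ is a metric of signature $(-+++)$ and $\Gamma$ is an arbitrary linear connection with torsion $T^\alpha_{\beta\gamma}=\Gamma^\alpha_{\beta\gamma}-\Gamma^\alpha_{\gamma\beta}$. Put $\varrho=\sqrt{|\det g|}$. For a first-order Lagrangian density $L\,\mathrm d^4x$ on the jet bundle with coordinates $(x^\mu,y^A,y^A_\mu)$, the Legendre map is $(x^\mu,y^A,p_A^\mu=\partial L/\partial y^A_\mu)$, with values in the restricted multimomentum bundle; the extended Legendre map has in addition $p=L-y^A_\mu\,\partial L/\partial y^A_\mu$, with values in the extended multimomentum bundle, whose Liouville forms are $\Theta=p\,\mathrm d^4x+p_A^\mu\,\mathrm dy^A\wedge\mathrm d^3x_\mu$ and $\Omega=-\mathrm d\Theta$.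 The Poincaré–Cartan form is $\Omega_L=-\mathrm d\Theta_L$, $\Theta_L=\frac{\partial L}{\partial y^A_\mu}\mathrm dy^A\wedge\mathrm d^3x_\mu+\big(L-y^A_\mu\frac{\partial L}{\partial y^A_\mu}\big)\mathrm d^4x$. *Einstein–Palatini model.* On $J^1\pi$, $\pi:E\to M$, let $L_{\rm EP}=\varrho\,g^{\alpha\beta}R_{\alpha\beta}$ with $R_{\alpha\beta}=\Gamma^\gamma_{\beta\alpha,\gamma}-\Gamma^\gamma_{\gamma\alpha,\beta}+\Gamma^\gamma_{\beta\alpha}\Gamma^\sigma_{\sigma\gamma}-\Gamma^\gamma_{\beta\sigma}\Gamma^\sigma_{\gamma\alpha}$. Let $\mathcal P$ and $\widetilde{\mathcal P}$ be the images of its Legendre map and of its extended Legendre map. The natural projection $\widetilde{\mathcal P}\to\mathcal P$ is a diffeomorphism, and the Hamilton–Cartan form $\Omega_H$ on $\mathcal P$ is the pullback of $\Omega$ by its inverse. The projection $\mathcal P\to E$ is a diffeomorphism, which makes $(x^\mu,g_{\alpha\beta},\Gamma^\alpha_{\beta\gamma})$ coordinates on $\mathcal P$. Let $\jmath_f:\mathcal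 P_f\hookrightarrow\mathcal P$ be the final constraint submanifold, defined by the torsion constraints $T^\alpha_{\beta\gamma}=\frac13\delta^\alpha_\beta T^\nu_{\nu\gamma}-\frac13\delta^\alpha_\gamma T^\nu_{\nu\beta}$. *First-order Einstein–Hilbert model.* On $J^1\pi_\Sigma$, $\pi_\Sigma:\Sigma\to M$, with coordinates $(x^\mu,g_{\alpha\beta},g_{\alpha\beta,\mu})$, let $$\overline L=L_0-\sum_{\alpha\le\beta,\ \lambda\le\sigma}g_{\alpha\beta,\mu}\,g_{\lambda\sigma,\nu}\frac{\partial L^{\alpha\beta,\mu\nu}}{\partial g_{\lambda\sigma}},\qquad L^{\alpha\beta,\mu\nu}=\tfrac{n(\alpha\beta)}2\varrho\,(g^{\alpha\mu}g^{\beta\nu}+g^{\alpha\nu}g^{\beta\mu}-2g^{\alpha\beta}g^{\mu\nu}),$$ $$L_0=\varrho\,g^{\alpha\beta}\{g^{\gamma\delta}(g_{\delta\mu,\beta}\tilde\Gamma^\mu_{\alpha\gamma}-g_{\delta\mu,\gamma}\tilde\Gamma^\mu_{\alpha\beta})+\tilde\Gamma^\delta_{\alpha\beta}\tilde\Gamma^\gamma_{\gamma\delta}-\tilde\Gamma^\delta_{\alpha\gamma}\tilde\Gamma^\gamma_{\beta\delta}\},$$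 where $n(\alpha\beta)=1$ if $\alpha=\beta$ and $2$ otherwise, and $\tilde\Gamma$ are the Levi-Civita Christoffel symbols of $g$. Let $\Omega_{\overline{\mathcal L}}$ be the Poincaré–Cartan form of $\overline L$, let $\mathcal F\overline{\mathcal L}$ be its Legendre map, a diffeomorphism, and let $\Omega_{\overline h}=((\mathcal F\overline{\mathcal L})^{-1})^*\Omega_{\overline{\mathcal L}}$. *Claim.* Let $\xi(x^\mu,g_{\alpha\beta},\Gamma^\alpha_{\beta\gamma})=(x^\mu,g_{\alpha\beta},\overline g_{\alpha\beta,\mu})$ with $\overline g_{\alpha\beta,\mu}=g_{\alpha\lambda}\Gamma^\lambda_{\mu\beta}+g_{\beta\lambda}\Gamma^\lambda_{\mu\alpha}+\frac23g_{\alpha\beta}T^\lambda_{\lambda\mu}$, considered on $\mathcal P_f$. Then, as 5-forms on $\mathcal P_f$, $$\jmath_f^*\Omega_H=(\xi\circ\jmath_f)^*\Omega_{\overline{\mathcal L}}=(\mathcal F\overline{\mathcal L}\circ\xi\circ\jmath_f)^*\Omega_{\overline h}.$$ -/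

import Mathlib

noncomputable section

namespace EinsteinPalatini

open Function

/-! ### Differential forms on (open subsets of) normed spaces -/

section Forms

variable {V W : Type*} [NormedAddCommGroup V] [NormedSpace ℝ V]
  [NormedAddCommGroup W] [NormedSpace ℝ W]

/-- Pullback `f^* ω` of a differential `k`-form. -/
def pullback {k : ℕ} (f : V → W) (ω : W → W [⋀^Fin k]→L[ℝ] ℝ) (v : V) : V [⋀^Fin k]→L[ℝ] ℝ :=
  (ω (f v)).compContinuousLinearMap (fderiv ℝ f v)

/-- The determinant as a continuous alternating form on `ℝ⁴`. -/
def detForm : (Fin 4 → ℝ) [⋀^Fin 4]→L[ℝ] ℝ :=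
  { (Matrix.detRowAlternating : (Fin 4 → ℝ) [⋀^Fin 4]→ₗ[ℝ] ℝ) with
    cont := Continuous.matrix_det (A := fun v : Fin 4 → Fin 4 → ℝ => Matrix.of v) continuous_id }

/-- The exterior product `θ₀ ∧ θ₁ ∧ θ₂ ∧ θ₃` of four covectors,
`(v₀, …, v₃) ↦ det (θ_j (v_i))`. -/
def wedge (θ : Fin 4 → V →L[ℝ] ℝ) : V [⋀^Fin 4]→L[ℝ] ℝ :=
  detForm.compContinuousLinearMap (ContinuousLinearMap.pi θ)

end Forms

/-! ### First-order field theory on a trivial bundle over a coordinate domain of space-time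

`F` is the typical fibre; all bundles are written in natural coordinates. -/

/-- Coordinates `x^μ` of space-time. -/
abbrev Base := Fin 4 → ℝ

section FieldTheory

variable (F : Type*) [NormedAddCommGroup F] [NormedSpace ℝ F]

/-- The configuration bundle, with coordinates `(x^μ, y)`. -/
abbrev Conf := Base × F

/-- The first jet bundle, with coordinates `(x^μ, y, y_{,μ})`. -/
abbrev Jet := Base × F × (Fin 4 → F)

/-- The restricted multimomentum bundle, with coordinates `(x^μ, y, p^μ)`. The momenta `p^μ` are
covectors on the fibre. -/
abbrev RMom := Base × F × (Fin 4 → F →L[ℝ] ℝ)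

/-- The extended multimomentum bundle, with coordinates `((x^μ, y, p^μ), p)`. The projection `μ`
onto the restricted multimomentum bundle is `Prod.fst`. -/
abbrev EMom := RMom F × ℝ

variable {F}

/-- The projection of the restricted multimomentum bundle onto the configuration bundle. -/
def tau (q : RMom F) : Conf F := (q.1, q.2.1)

/-- The coordinate covector `dx^ν` on the configuration bundle. -/
def dx (ν : Fin 4) : Conf F →L[ℝ] ℝ :=
  (ContinuousLinearMap.proj ν).comp (ContinuousLinearMap.fst ℝ Base F)

/-- The covector `θ ∘ dy` on the configuration bundle, for a covector `θ` on the fibre. -/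
def dy (θ : F →L[ℝ] ℝ) : Conf F →L[ℝ] ℝ := θ.comp (ContinuousLinearMap.snd ℝ Base F)

/-- The point of the extended multimomentum bundle as a `4`-form on the configuration bundle,
`p d⁴x + ∑_μ (p^μ ∘ dy) ∧ d³x_μ`, where `d³x_μ = i(∂/∂x^μ) d⁴x`. For a covector `θ`, the form
`θ ∧ d³x_μ` is `dx⁰ ∧ dx¹ ∧ dx² ∧ dx³` with the factor `dx^μ` replaced by `θ`. -/
def multiForm (m : EMom F) : Conf F [⋀^Fin 4]→L[ℝ] ℝ :=
  m.2 • wedge dx + ∑ μ, wedge (update dx μ (dy (m.1.2.2 μ)))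

/-- The tautological (Liouville) `4`-form `Θ` of the extended multimomentum bundle. -/
def liouvilleTheta (m : EMom F) : EMom F [⋀^Fin 4]→L[ℝ] ℝ :=
  (multiForm m).compContinuousLinearMap
    (((ContinuousLinearMap.fst ℝ Base (F × (Fin 4 → F →L[ℝ] ℝ))).prod
      ((ContinuousLinearMap.fst ℝ F (Fin 4 → F →L[ℝ] ℝ)).comp
        (ContinuousLinearMap.snd ℝ Base (F × (Fin 4 → F →L[ℝ] ℝ))))).comp
      (ContinuousLinearMap.fst ℝ (RMom F) ℝ))

/-- The canonical (Liouville) `5`-form `Ω = -dΘ`. -/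
def liouvilleOmega (m : EMom F) : EMom F [⋀^Fin 5]→L[ℝ] ℝ :=
  -extDeriv (liouvilleTheta (F := F)) m

/-- The fibre derivative `∂L/∂y_{,μ}`, a covector on the fibre. -/
def momentum (L : Jet F → ℝ) (j : Jet F) (μ : Fin 4) : F →L[ℝ] ℝ :=
  (fderiv ℝ (fun u : Fin 4 → F => L (j.1, j.2.1, u)) j.2.2).comp
    (ContinuousLinearMap.single ℝ (fun _ : Fin 4 => F) μ)

/-- The Legendre map of the Lagrangian density `L d⁴x`. -/
def legendre (L : Jet F → ℝ) (j : Jet F) : RMom F := (j.1, j.2.1, momentum L j)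

/-- The extended Legendre map: `p = L - y_{,μ} ∂L/∂y_{,μ}`. -/
def extLegendre (L : Jet F → ℝ) (j : Jet F) : EMom F :=
  (legendre L j, L j - ∑ μ, momentum L j μ (j.2.2 μ))

/-- The Poincaré–Cartan `4`-form
`Θ_L = (∂L/∂y_{,μ}) dy ∧ d³x_μ + (L - y_{,μ} ∂L/∂y_{,μ}) d⁴x` on the jet bundle. -/
def poincareCartanTheta (L : Jet F → ℝ) (j : Jet F) : Jet F [⋀^Fin 4]→L[ℝ] ℝ :=
  (multiForm (extLegendre L j)).compContinuousLinearMap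
    ((ContinuousLinearMap.fst ℝ Base (F × (Fin 4 → F))).prod
      ((ContinuousLinearMap.fst ℝ F (Fin 4 → F)).comp
        (ContinuousLinearMap.snd ℝ Base (F × (Fin 4 → F)))))

/-- The Poincaré–Cartan `5`-form `Ω_L = -dΘ_L` on the jet bundle. -/
def poincareCartanOmega (L : Jet F → ℝ) (j : Jet F) : Jet F [⋀^Fin 5]→L[ℝ] ℝ :=
  -extDeriv (poincareCartanTheta L) j

end FieldTheory

/-! ### Metrics and connections -/

/-- Components `g_{αβ}` of a metric: one real for every unordered pair of indices. -/
abbrev Met := Sym2 (Fin 4) → ℝ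

/-- Components `Γ^α_{βγ} = Γ α β γ` of a linear connection (no symmetry is assumed). -/
abbrev Con := Fin 4 → Fin 4 → Fin 4 → ℝ

/-- The matrix `(g_{αβ})`. -/
def gMat (g : Met) : Matrix (Fin 4) (Fin 4) ℝ := Matrix.of fun α β => g s(α, β)

/-- The inverse matrix `(g^{αβ})`. -/
def gInv (g : Met) : Matrix (Fin 4) (Fin 4) ℝ := (gMat g)⁻¹

/-- `ϱ = √|det g|`. -/
def rho (g : Met) : ℝ := Real.sqrt |(gMat g).det|

/-- `g` has signature `(-+++)`. -/
def IsLorentz (g : Met) : Prop :=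
  ∃ A : Matrix (Fin 4) (Fin 4) ℝ, IsUnit A.det ∧
    A.transpose * gMat g * A = Matrix.diagonal ![-1, 1, 1, 1]

/-- The torsion components `T^α_{βγ} = Γ^α_{βγ} - Γ^α_{γβ}`. -/
def torsion (Γ : Con) (α β γ : Fin 4) : ℝ := Γ α β γ - Γ α γ β

/-- Kronecker's delta. -/
def delta (α β : Fin 4) : ℝ := if α = β then 1 else 0

/-! ### The Einstein–Palatini model -/

/-- The fibre of `Σ ×_M C(LM)` (without the open condition on the signature of the metric). -/
abbrev MetCon := Met × Con

/-- The Ricci components `R_{αβ}`, with `dΓ μ α β γ = Γ^α_{βγ,μ}`. -/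
def ricci (Γ : Con) (dΓ : Fin 4 → Con) (α β : Fin 4) : ℝ :=
  ∑ γ, (dΓ γ γ β α - dΓ β γ γ α) +
    ∑ γ, ∑ σ, (Γ γ β α * Γ σ σ γ - Γ γ β σ * Γ σ γ α)

/-- The Einstein–Palatini Lagrangian function `L_EP = ϱ g^{αβ} R_{αβ}`. -/
def lagEP (j : Jet MetCon) : ℝ :=
  rho j.2.1.1 * ∑ α, ∑ β, gInv j.2.1.1 α β * ricci j.2.1.2 (fun μ => (j.2.2 μ).2) α β

/-- The configuration bundle `E` over the coordinate domain `U`. -/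
def confEP (U : Set Base) : Set (Conf MetCon) := {c | c.1 ∈ U ∧ IsLorentz c.2.1}

/-- The first jet bundle `J¹π` over the coordinate domain `U`. -/
def jetEP (U : Set Base) : Set (Jet MetCon) := {j | j.1 ∈ U ∧ IsLorentz j.2.1.1}

/-- `𝒫`, the image of the Legendre map, in the restricted multimomentum bundle. -/
def imageP (U : Set Base) : Set (RMom MetCon) := legendre lagEP '' jetEP U

/-- `𝒫̃`, the image of the extended Legendre map, in the extended multimomentum bundle. -/
def imagePtilde (U : Set Base) : Set (EMom MetCon) := extLegendre lagEP '' jetEP U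

/-- The Hamiltonian section on `𝒫`: the inverse of the bijection `μ̃ : 𝒫̃ → 𝒫`. -/
def hamSection (U : Set Base) : RMom MetCon → EMom MetCon := invFunOn Prod.fst (imagePtilde U)

/-- The inverse of the diffeomorphism `τ_𝒫 : 𝒫 → E`. It gives the non-momenta coordinates
`(x^μ, g_{αβ}, Γ^α_{βγ})` on `𝒫`. -/
def nonMomenta (U : Set Base) : Conf MetCon → RMom MetCon := invFunOn tau (imageP U)

/-- The Hamilton–Cartan form `Ω_H` on `𝒫`, the pullback of the Liouville form by the Hamiltonian
section, in the non-momenta coordinates of `𝒫`. -/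
def omegaH (U : Set Base) : Conf MetCon → Conf MetCon [⋀^Fin 5]→L[ℝ] ℝ :=
  pullback (hamSection U ∘ nonMomenta U) liouvilleOmega

/-- The linear subspace of the non-momenta coordinate space given by the torsion constraints
`T^α_{βγ} = (1/3) δ^α_β T^ν_{νγ} - (1/3) δ^α_γ T^ν_{νβ}`. The final constraint submanifold `𝒫_f`
is the open subset of it that lies in `confEP U`. -/
def torsionSpace : Submodule ℝ (Conf MetCon) where
  carrier := {c | ∀ α β γ, torsion c.2.2 α β γ =
    (1 / 3) * delta α β * ∑ ν, torsion c.2.2 ν ν γ - (1 / 3) * delta α γ * ∑ ν, torsion c.2.2 ν ν β}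
  add_mem' := by
    intro a b ha hb α β γ
    have h1 := ha α β γ
    have h2 := hb α β γ
    simp only [torsion, Fin.sum_univ_four, Prod.snd_add, Pi.add_apply] at h1 h2 ⊢
    linear_combination h1 + h2
  zero_mem' := by
    intro α β γ
    simp [torsion]
  smul_mem' := by
    intro r a ha α β γ
    have h1 := ha α β γ
    simp only [torsion, Fin.sum_univ_four, Prod.smul_snd, Pi.smul_apply, smul_eq_mul] at h1 ⊢
    linear_combination r * h1

/-- The embedding `𝒫_f ↪ 𝒫` in non-momenta coordinates. -/
def embPf (w : torsionSpace) : Conf MetCon := w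

/-- `𝒫_f` over the coordinate domain `U`, in non-momenta coordinates. -/
def finalP (U : Set Base) : Set torsionSpace := {w | embPf w ∈ confEP U}

/-! ### The first-order Einstein–Hilbert model -/

/-- The first jet bundle `J¹π_Σ` over the coordinate domain `U`. -/
def jetEH (U : Set Base) : Set (Jet Met) := {j | j.1 ∈ U ∧ IsLorentz j.2.1}

/-- The Levi-Civita Christoffel symbols `Γ̃^μ_{αγ}`, where `v μ s(α, β) = g_{αβ,μ}`. -/
def christoffel (g : Met) (v : Fin 4 → Met) (μ α γ : Fin 4) : ℝ :=
  (1 / 2) * ∑ ν, gInv g μ ν * (v α s(ν, γ) + v γ s(ν, α) - v ν s(α, γ))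

/-- `n(αβ)`. -/
def nFactor (α β : Fin 4) : ℝ := if α = β then 1 else 2

/-- `L^{αβ,μν} = (n(αβ)/2) ϱ (g^{αμ} g^{βν} + g^{αν} g^{βμ} - 2 g^{αβ} g^{μν})`. -/
def lagCoeff (α β μ ν : Fin 4) (g : Met) : ℝ :=
  nFactor α β / 2 * rho g *
    (gInv g α μ * gInv g β ν + gInv g α ν * gInv g β μ - 2 * gInv g α β * gInv g μ ν)

/-- The partial derivative `∂f/∂g_{λσ}`. -/
def partialMet (f : Met → ℝ) (l s : Fin 4) (g : Met) : ℝ :=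
  fderiv ℝ f g (Pi.single s(l, s) 1)

/-- The function `L₀`. -/
def lagZero (g : Met) (v : Fin 4 → Met) : ℝ :=
  rho g * ∑ α, ∑ β, gInv g α β *
    (∑ γ, ∑ δ, gInv g γ δ *
        ∑ μ, (v β s(δ, μ) * christoffel g v μ α γ - v γ s(δ, μ) * christoffel g v μ α β) +
      ∑ γ, ∑ δ, (christoffel g v δ α β * christoffel g v γ γ δ -
        christoffel g v δ α γ * christoffel g v γ β δ))

/-- The first-order Lagrangian function
`L̄ = L₀ - ∑_{α ≤ β, λ ≤ σ} g_{αβ,μ} g_{λσ,ν} ∂L^{αβ,μν}/∂g_{λσ}`. -/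
def lagBar (j : Jet Met) : ℝ :=
  lagZero j.2.1 j.2.2 -
    ∑ α, ∑ β ∈ Finset.Ici α, ∑ l, ∑ s ∈ Finset.Ici l, ∑ μ, ∑ ν,
      j.2.2 μ s(α, β) * j.2.2 ν s(l, s) * partialMet (lagCoeff α β μ ν) l s j.2.1

/-- The Poincaré–Cartan form `Ω_{L̄}` on `J¹π_Σ`. -/
def omegaLbar : Jet Met → Jet Met [⋀^Fin 5]→L[ℝ] ℝ := poincareCartanOmega lagBar

/-- The Hamilton–Cartan form `Ω_{h̄} = ((FL̄)⁻¹)^* Ω_{L̄}` on the restricted multimomentum bundle,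
where `FL̄` is the Legendre map of `L̄` on `J¹π_Σ`. -/
def omegaHbar (U : Set Base) : RMom Met → RMom Met [⋀^Fin 5]→L[ℝ] ℝ :=
  pullback (invFunOn (legendre lagBar) (jetEH U)) omegaLbar

/-! ### The map `ξ` -/

/-- `ḡ_{αβ,μ} = g_{αλ} Γ^λ_{μβ} + g_{βλ} Γ^λ_{μα} + (2/3) g_{αβ} T^λ_{λμ}`. -/
def gBar (g : Met) (Γ : Con) (μ : Fin 4) : Met := fun p =>
  Sym2.lift ⟨fun α β => ∑ l, (g s(α, l) * Γ l μ β + g s(β, l) * Γ l μ α) +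
      (2 / 3) * g s(α, β) * ∑ l, torsion Γ l l μ, by
    intro α β
    simp only [Sym2.eq_swap (a := β) (b := α), add_comm (g s(α, _) * _)]⟩ p

/-- The map `ξ(x^μ, g_{αβ}, Γ^α_{βγ}) = (x^μ, g_{αβ}, ḡ_{αβ,μ})` in non-momenta coordinates. -/
def xi (c : Conf MetCon) : Jet Met := (c.1, c.2.1, gBar c.2.1 c.2.2)

end EinsteinPalatini

end

/-! The two Liouville-type 4-forms, pulled back to `torsionSpace`, differ by a closed form, so their
exterior derivatives agree.

On the Palatini side `lagEP` is affine in the velocities (`lagEP_eq`). Its momenta depend on `g`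
alone, and the Hamiltonian section is the explicit map `sectionPal` (`hamSection_nonMomenta`). The
pulled-back form is `Q(Γ,Γ) d⁴x + ϱ g^{αβ} (dΓ^μ_{βα} - δ^μ_β dΓ^γ_{γα}) ∧ d³x_μ`, where `Q(Γ,Γ)` is
`ϱ g^{αβ}` contracted with the quadratic part of the Ricci tensor.

On the Einstein–Hilbert side metricity of the Levi-Civita connection turns `lagBar` into `-Q(Γ̃,Γ̃)`
(`lagBar_eq`). It is homogeneous quadratic in the velocities, so `p = Q(Γ̃,Γ̃)`, and the momenta
give `-(Γ̃^μ_{βα} - δ^μ_β Γ̃^γ_{γα}) d(ϱ g^{αβ}) ∧ d³x_μ` (`momentum_lagBar`).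

The torsion constraints say that `Γ` differs from the Levi-Civita symbols built from `ḡ` by a
projective term `δ^a_d A_b` (`christoffel_gBar`). Both `Q` and the contraction defining the momenta
are insensitive to such a term (`ricciQuad_projective`, `conPair_projective`), so `Γ̃` may be
replaced by `Γ`. By the Leibniz rule the two 4-forms then differ by `∑_μ dW^μ ∧ d³x_μ` with `W^μ = ϱ
g^{αβ} (Γ^μ_{βα} - δ^μ_β Γ^γ_{γα})` (`pullback_theta`). Each summand is the pullback of the constant
volume form of `ℝ⁴`, hence closed.

The second equality is formal once the Legendre map of `lagBar` is known to be injective with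
differentiable inverse. Injectivity comes from `eq_zero_of_momentumBar`, differentiability from the
inverse function theorem. That theorem is applied on an open domain, which requires openness of the
Lorentz signature (`isOpen_isLorentz`). -/

noncomputable section

namespace EinsteinPalatini

open Function Filter Topology

/-! ### Wedge products, pullbacks and closedness -/

section Forms

variable {V W X : Type*} [NormedAddCommGroup V] [NormedSpace ℝ V]
  [NormedAddCommGroup W] [NormedSpace ℝ W] [NormedAddCommGroup X] [NormedSpace ℝ X]

lemma wedge_apply (θ : Fin 4 → V →L[ℝ] ℝ) (v : Fin 4 → V) :
    wedge θ v = (Matrix.of fun i j => θ j (v i)).det := rfl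

lemma wedge_update_apply (θ : Fin 4 → V →L[ℝ] ℝ) (μ : Fin 4) (a : V →L[ℝ] ℝ) (v : Fin 4 → V) :
    wedge (update θ μ a) v =
      ((Matrix.of fun i j => θ j (v i)).updateCol μ fun i => a (v i)).det := by
  rw [wedge_apply]
  congr 1
  ext i j
  by_cases h : j = μ
  · subst h; simp
  · simp [h]

lemma wedge_update_add (θ : Fin 4 → V →L[ℝ] ℝ) (μ : Fin 4) (a b : V →L[ℝ] ℝ) :
    wedge (update θ μ (a + b)) = wedge (update θ μ a) + wedge (update θ μ b) := by
  ext v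
  rw [ContinuousAlternatingMap.add_apply]
  simp only [wedge_update_apply]
  exact Matrix.det_updateCol_add _ _ _ _

lemma wedge_update_smul (θ : Fin 4 → V →L[ℝ] ℝ) (μ : Fin 4) (r : ℝ) (a : V →L[ℝ] ℝ) :
    wedge (update θ μ (r • a)) = r • wedge (update θ μ a) := by
  ext v
  rw [ContinuousAlternatingMap.smul_apply]
  simp only [wedge_update_apply]
  exact Matrix.det_updateCol_smul _ _ _ _

lemma wedge_comp (θ : Fin 4 → W →L[ℝ] ℝ) (f : V →L[ℝ] W) :
    (wedge θ).compContinuousLinearMap f = wedge fun j => (θ j).comp f := rfl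

lemma wedge_update_comp (θ : Fin 4 → W →L[ℝ] ℝ) (μ : Fin 4) (a : W →L[ℝ] ℝ) (f : V →L[ℝ] W) :
    (wedge (update θ μ a)).compContinuousLinearMap f =
      wedge (update (fun j => (θ j).comp f) μ (a.comp f)) := by
  rw [wedge_comp]
  congr 1
  ext j : 1
  by_cases h : j = μ
  · subst h; simp
  · simp [h]

lemma pullback_comp {k : ℕ} {g : W → X} {f : V → W} {v : V} (ω : X → X [⋀^Fin k]→L[ℝ] ℝ)
    (hg : DifferentiableAt ℝ g (f v)) (hf : DifferentiableAt ℝ f v) :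
    pullback (g ∘ f) ω v = pullback f (pullback g ω) v := by
  unfold pullback
  rw [fderiv_comp v hg hf]
  rfl

/-- A pullback at `v` depends only on the germ of the map. This lets the choice-based inverses
`invFunOn` be replaced by explicit maps on open sets. -/
lemma pullback_congr {k : ℕ} {f g : V → W} {v : V} (ω : W → W [⋀^Fin k]→L[ℝ] ℝ)
    (h : f =ᶠ[𝓝 v] g) : pullback f ω v = pullback g ω v := by
  unfold pullback
  rw [h.fderiv_eq, h.eq_of_nhds]

lemma pullback_neg_extDeriv {k : ℕ} {f : V → W} {v : V} {ω : W → W [⋀^Fin k]→L[ℝ] ℝ}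
    (hω : DifferentiableAt ℝ ω (f v)) (hf : ContDiffAt ℝ 2 f v) :
    pullback f (fun x => -extDeriv ω x) v = -extDeriv (pullback f ω) v := by
  have h := extDeriv_pullback hω hf (by simp)
  change _ = -extDeriv (fun x => (ω (f x)).compContinuousLinearMap (fderiv ℝ f x)) v
  rw [h]
  rfl

/-- The form `d⁴ψ = dψ⁰ ∧ dψ¹ ∧ dψ² ∧ dψ³` is closed. -/
lemma extDeriv_wedge_fderiv {ψ : V → Fin 4 → ℝ} {v : V} (hψ : ContDiffAt ℝ 2 ψ v) :
    extDeriv (pullback ψ fun _ => detForm) v = 0 := by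
  -- A form with constant coefficients on `ℝ⁴` is closed, and `d` commutes with pullback along a C²
  -- map.
  have h := extDeriv_pullback (x := v) (ω := fun _ : Fin 4 → ℝ => detForm)
    (differentiableAt_const _) hψ (by simp)
  change extDeriv (fun x => detForm.compContinuousLinearMap (fderiv ℝ ψ x)) v = 0
  rw [h]
  ext w
  simp [extDeriv_apply]

lemma pullback_detForm {ψ : V → Fin 4 → ℝ} {v : V} (hψ : DifferentiableAt ℝ ψ v) :
    pullback ψ (fun _ => detForm) v = wedge fun j => fderiv ℝ (fun x => ψ x j) v := by
  unfold pullback wedge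
  congr 1
  ext w j
  have h := hasFDerivAt_pi'.1 hψ.hasFDerivAt j
  exact (congrArg (fun l : V →L[ℝ] ℝ => l w) h.fderiv).symm

end Forms

/-! ### Regularity and pullback of the Liouville and Poincaré–Cartan forms -/

section FieldTheory

variable {F : Type*} [NormedAddCommGroup F] [NormedSpace ℝ F]

/-- `multiForm` as a linear map in the momenta. -/
def multiFormLin : ((Fin 4 → F →L[ℝ] ℝ) × ℝ) →ₗ[ℝ] Conf F [⋀^Fin 4]→L[ℝ] ℝ where
  toFun q := q.2 • wedge dx + ∑ μ, wedge (update dx μ (dy (q.1 μ)))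
  map_add' a b := by
    have h : ∀ μ, dy ((a + b).1 μ) = dy (a.1 μ) + dy (b.1 μ) := fun μ => rfl
    simp only [h, wedge_update_add, Finset.sum_add_distrib, Prod.snd_add, add_smul]
    abel
  map_smul' r a := by
    have h : ∀ μ, dy ((r • a).1 μ) = r • dy (a.1 μ) := fun μ => rfl
    simp only [h, wedge_update_smul, Prod.smul_snd, smul_add, Finset.smul_sum, smul_smul,
      RingHom.id_apply, smul_eq_mul]

/-- The form depends linearly on `(p^μ, p)` and not at all on the base point; linear maps out of a
finite-dimensional space are smooth. -/
lemma differentiable_multiForm_comp [FiniteDimensional ℝ F] {V : Type*} [NormedAddCommGroup V]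
    [NormedSpace ℝ V] (f : V →L[ℝ] Conf F) :
    Differentiable ℝ fun m : EMom F => (multiForm m).compContinuousLinearMap f := by
  have h : Differentiable ℝ
      ((ContinuousAlternatingMap.compContinuousLinearMapₗ f).comp (multiFormLin (F := F))) :=
    (LinearMap.toContinuousLinearMap
      ((ContinuousAlternatingMap.compContinuousLinearMapₗ f).comp
        (multiFormLin (F := F)))).differentiable
  exact h.comp (f := fun m : EMom F => (m.1.2.2, m.2)) (by fun_prop)

lemma differentiable_liouvilleTheta [FiniteDimensional ℝ F] :
    Differentiable ℝ (liouvilleTheta (F := F)) :=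
  differentiable_multiForm_comp _

lemma differentiableAt_poincareCartanTheta [FiniteDimensional ℝ F] {L : Jet F → ℝ} {j : Jet F}
    (h : DifferentiableAt ℝ (extLegendre L) j) :
    DifferentiableAt ℝ (poincareCartanTheta L) j := by
  have h1 := differentiable_multiForm_comp (F := F)
    ((ContinuousLinearMap.fst ℝ Base (F × (Fin 4 → F))).prod
      ((ContinuousLinearMap.fst ℝ F (Fin 4 → F)).comp
        (ContinuousLinearMap.snd ℝ Base (F × (Fin 4 → F))))) (extLegendre L j)
  exact DifferentiableAt.comp j h1 h

lemma multiForm_comp (m : EMom F) {V : Type*} [NormedAddCommGroup V] [NormedSpace ℝ V]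
    (f : V →L[ℝ] Conf F) :
    (multiForm m).compContinuousLinearMap f =
      m.2 • wedge (fun ν => (dx ν).comp f) +
        ∑ μ, wedge (update (fun ν => (dx ν).comp f) μ ((dy (m.1.2.2 μ)).comp f)) := by
  simp only [← wedge_update_comp, ← wedge_comp, multiForm]
  ext v
  simp

/-- If `Φ` is a section of the extended multimomentum bundle over the configuration bundle, then
the pullback of the Liouville form is the value of the section. -/
lemma pullback_liouvilleTheta {V : Type*} [NormedAddCommGroup V] [NormedSpace ℝ V]
    {Φ : V → EMom F} {v : V} (hΦ : DifferentiableAt ℝ Φ v) :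
    pullback Φ liouvilleTheta v =
      (multiForm (Φ v)).compContinuousLinearMap
        (fderiv ℝ (fun x => ((Φ x).1.1, (Φ x).1.2.1)) v) := by
  set P : EMom F →L[ℝ] Conf F :=
    (((ContinuousLinearMap.fst ℝ Base (F × (Fin 4 → F →L[ℝ] ℝ))).prod
      ((ContinuousLinearMap.fst ℝ F (Fin 4 → F →L[ℝ] ℝ)).comp
        (ContinuousLinearMap.snd ℝ Base (F × (Fin 4 → F →L[ℝ] ℝ))))).comp
      (ContinuousLinearMap.fst ℝ (RMom F) ℝ)) with hP
  have h : fderiv ℝ (P ∘ Φ) v = P.comp (fderiv ℝ Φ v) := by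
    rw [fderiv_comp v P.differentiableAt hΦ, P.fderiv]
  change ((multiForm (Φ v)).compContinuousLinearMap P).compContinuousLinearMap (fderiv ℝ Φ v) =
    (multiForm (Φ v)).compContinuousLinearMap (fderiv ℝ (P ∘ Φ) v)
  rw [h]
  rfl

lemma pullback_poincareCartanTheta {V : Type*} [NormedAddCommGroup V] [NormedSpace ℝ V]
    (L : Jet F → ℝ) {Ψ : V → Jet F} {v : V} (hΨ : DifferentiableAt ℝ Ψ v) :
    pullback Ψ (poincareCartanTheta L) v =
      (multiForm (extLegendre L (Ψ v))).compContinuousLinearMap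
        (fderiv ℝ (fun x => ((Ψ x).1, (Ψ x).2.1)) v) := by
  set P : Jet F →L[ℝ] Conf F :=
    ((ContinuousLinearMap.fst ℝ Base (F × (Fin 4 → F))).prod
      ((ContinuousLinearMap.fst ℝ F (Fin 4 → F)).comp
        (ContinuousLinearMap.snd ℝ Base (F × (Fin 4 → F))))) with hP
  have h : fderiv ℝ (P ∘ Ψ) v = P.comp (fderiv ℝ Ψ v) := by
    rw [fderiv_comp v P.differentiableAt hΨ, P.fderiv]
  change ((multiForm _).compContinuousLinearMap P).compContinuousLinearMap (fderiv ℝ Ψ v) =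
    (multiForm _).compContinuousLinearMap (fderiv ℝ (P ∘ Ψ) v)
  rw [h]
  rfl

end FieldTheory

/-! ### Algebra of connections -/

/-- The trace `Γ^γ_{γα}`. -/
def conTrace (Γ : Con) (α : Fin 4) : ℝ := ∑ γ, Γ γ γ α

/-- The polarised quadratic part of the Ricci tensor. -/
def ricciQuad (Γ Γ' : Con) (α β : Fin 4) : ℝ :=
  ∑ γ, ∑ σ, (Γ γ β α * Γ' σ σ γ - Γ γ β σ * Γ' σ γ α)

/-- The contraction `X^{αβ} (Γ^μ_{βα} - δ^μ_β Γ^γ_{γα})`. -/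
def conPair (X : Fin 4 → Fin 4 → ℝ) (Γ : Con) (μ : Fin 4) : ℝ :=
  ∑ α, ∑ β, X α β * (Γ μ β α - delta μ β * conTrace Γ α)

lemma sum_delta_mul (μ : Fin 4) (f : Fin 4 → ℝ) : ∑ β, delta μ β * f β = f μ := by
  simp [delta]

lemma sum_delta_mul' (μ : Fin 4) (f : Fin 4 → ℝ) : ∑ β, delta β μ * f β = f μ := by
  simp [delta]

lemma sum_mul_delta' (μ : Fin 4) (f : Fin 4 → ℝ) : ∑ β, f β * delta β μ = f μ := by
  simp [delta]

lemma ricci_eq (Γ : Con) (dΓ : Fin 4 → Con) (α β : Fin 4) :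
    ricci Γ dΓ α β = ∑ γ, (dΓ γ γ β α - dΓ β γ γ α) + ricciQuad Γ Γ α β := rfl

lemma conPair_eq (X : Fin 4 → Fin 4 → ℝ) (Γ : Con) (μ : Fin 4) :
    conPair X Γ μ = ∑ α, ∑ β, X α β * Γ μ β α - ∑ α, X α μ * conTrace Γ α := by
  simp only [conPair, mul_sub, Finset.sum_sub_distrib]
  congr 1
  refine Finset.sum_congr rfl fun α _ => ?_
  rw [← sum_delta_mul μ fun β => X α β * conTrace Γ α]
  exact Finset.sum_congr rfl fun β _ => by ring

lemma ricciQuad_eq (Γ Γ' : Con) (α β : Fin 4) :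
    ricciQuad Γ Γ' α β =
      ∑ γ, Γ γ β α * conTrace Γ' γ - ∑ γ, ∑ σ, Γ γ β σ * Γ' σ γ α := by
  simp only [ricciQuad, Finset.sum_sub_distrib, conTrace, Finset.mul_sum]

/-- The quadratic part of the Ricci tensor is invariant under projective changes of the
connection. -/
lemma ricciQuad_projective (Γ Γ' : Con) (A : Fin 4 → ℝ)
    (h : ∀ a b c, Γ' a b c = Γ a b c + delta a c * A b) (α β : Fin 4) :
    ricciQuad Γ' Γ' α β = ricciQuad Γ Γ α β := by
  have ht : ∀ γ, conTrace Γ' γ = conTrace Γ γ + A γ := by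
    intro γ
    simp only [conTrace, h, Finset.sum_add_distrib, sum_delta_mul']
  have h1 : ∑ γ, Γ' γ β α * conTrace Γ' γ = ∑ γ, Γ γ β α * conTrace Γ γ +
      ∑ γ, Γ γ β α * A γ + A β * conTrace Γ α + A β * A α := by
    simp only [h, ht]
    have : ∀ γ, (Γ γ β α + delta γ α * A β) * (conTrace Γ γ + A γ) =
        Γ γ β α * conTrace Γ γ + Γ γ β α * A γ + delta γ α * (A β * conTrace Γ γ)
          + delta γ α * (A β * A γ) := fun γ => by ring
    simp only [this, Finset.sum_add_distrib, sum_delta_mul']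
  have h2 : ∑ γ, ∑ σ, Γ' γ β σ * Γ' σ γ α = ∑ γ, ∑ σ, Γ γ β σ * Γ σ γ α +
      ∑ γ, Γ γ β α * A γ + A β * conTrace Γ α + A β * A α := by
    have : ∀ γ σ, Γ' γ β σ * Γ' σ γ α = Γ γ β σ * Γ σ γ α + delta σ α * (Γ γ β σ * A γ)
        + delta γ σ * (A β * Γ σ γ α) + delta γ σ * (delta σ α * (A β * A γ)) := fun γ σ => by
      rw [h, h]; ring
    simp only [this, Finset.sum_add_distrib, sum_delta_mul', sum_delta_mul, conTrace,
      Finset.mul_sum]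
  -- Both products acquire the same three extra terms, which cancel in the difference.
  rw [ricciQuad_eq, ricciQuad_eq, h1, h2]
  ring

/-- The first contraction gains `X^{μβ} A_β` and the trace part gains `X^{βμ} A_β`; symmetry of `X`
cancels them. -/
lemma conPair_projective (X : Fin 4 → Fin 4 → ℝ) (hX : ∀ a b, X a b = X b a) (Γ Γ' : Con)
    (A : Fin 4 → ℝ) (h : ∀ a b c, Γ' a b c = Γ a b c + delta a c * A b) (μ : Fin 4) :
    conPair X Γ' μ = conPair X Γ μ := by
  have ht : ∀ γ, conTrace Γ' γ = conTrace Γ γ + A γ := by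
    intro γ
    simp only [conTrace, h, Finset.sum_add_distrib, sum_delta_mul']
  have h1 : ∑ α, ∑ β, X α β * Γ' μ β α = ∑ α, ∑ β, X α β * Γ μ β α + ∑ β, X μ β * A β := by
    have : ∀ α β, X α β * Γ' μ β α = X α β * Γ μ β α + delta μ α * (X α β * A β) := fun α β => by
      rw [h]; ring
    simp only [this, Finset.sum_add_distrib, ← Finset.mul_sum, sum_delta_mul]
  have h2 : ∑ α, X α μ * conTrace Γ' α = ∑ α, X α μ * conTrace Γ α + ∑ β, X μ β * A β := by
    simp only [ht, mul_add, Finset.sum_add_distrib, hX μ]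
  rw [conPair_eq, conPair_eq, h1, h2]
  ring

/-- The polarised quadratic Lagrangian in terms of the covariant derivative of a symmetric
density that is parallel for `Γ'`. -/
lemma sum_conPair_parallel (S : Fin 4 → Fin 4 → ℝ) (Γ Γ' : Con)
    (hΓ' : ∀ a b c, Γ' a b c = Γ' a c b) :
    ∑ μ, conPair (fun α β => S α β * conTrace Γ' μ - ∑ l, Γ' α μ l * S l β
        - ∑ l, Γ' β μ l * S α l) Γ μ =
      ∑ α, ∑ β, S α β * (ricciQuad Γ Γ' α β + ricciQuad Γ' Γ α β) := by
  have e1 : ∀ μ, ∑ α, ∑ β, (S α β * conTrace Γ' μ - ∑ l, Γ' α μ l * S l β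
        - ∑ l, Γ' β μ l * S α l) * Γ μ β α =
      ∑ α, ∑ β, S α β * (Γ μ β α * conTrace Γ' μ)
        - ∑ α, ∑ β, ∑ l, S l β * (Γ μ β α * Γ' α μ l)
        - ∑ α, ∑ β, ∑ l, S α l * (Γ' β l μ * Γ μ β α) := by
    intro μ
    simp only [← Finset.sum_sub_distrib]
    refine Finset.sum_congr rfl fun α _ => Finset.sum_congr rfl fun β _ => ?_
    simp only [sub_mul, Finset.sum_mul]
    congr 1
    · congr 1
      · ring
      · exact Finset.sum_congr rfl fun l _ => by ring
    · exact Finset.sum_congr rfl fun l _ => by rw [hΓ' β μ l]; ring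
  have e2 : ∑ μ, ∑ α, (S α μ * conTrace Γ' μ - ∑ l, Γ' α μ l * S l μ
        - ∑ l, Γ' μ μ l * S α l) * conTrace Γ α =
      - ∑ μ, ∑ α, ∑ l, S l μ * (Γ' α μ l * conTrace Γ α) := by
    -- Contracting `β` with `μ` turns `Γ'^β_{μl}` into the trace of `Γ'`, which cancels the density
    -- term.
    have e3 : ∑ μ, ∑ α, (∑ l, Γ' μ μ l * S α l) * conTrace Γ α =
        ∑ μ, ∑ α, S α μ * conTrace Γ' μ * conTrace Γ α := by
      rw [Finset.sum_comm, Finset.sum_comm (f := fun μ α => S α μ * conTrace Γ' μ * conTrace Γ α)]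
      refine Finset.sum_congr rfl fun α _ => ?_
      rw [← Finset.sum_mul, ← Finset.sum_mul, Finset.sum_comm]
      refine congrArg (· * conTrace Γ α) (Finset.sum_congr rfl fun l _ => ?_)
      rw [conTrace, Finset.mul_sum]
      exact Finset.sum_congr rfl fun μ _ => mul_comm _ _
    simp only [sub_mul, Finset.sum_sub_distrib, e3]
    have : ∀ μ α, (∑ l, Γ' α μ l * S l μ) * conTrace Γ α =
        ∑ l, S l μ * (Γ' α μ l * conTrace Γ α) := fun μ α => by
      rw [Finset.sum_mul]
      exact Finset.sum_congr rfl fun l _ => by ring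
    simp only [this]
    ring
  simp only [conPair_eq, e1, Finset.sum_sub_distrib, e2, ricciQuad_eq, mul_add, mul_sub,
    Finset.sum_add_distrib, Finset.mul_sum]
  have f1 : ∑ μ, ∑ α, ∑ β, S α β * (Γ μ β α * conTrace Γ' μ) =
      ∑ α, ∑ β, ∑ μ, S α β * (Γ μ β α * conTrace Γ' μ) := by
    rw [Finset.sum_comm]
    exact Finset.sum_congr rfl fun α _ => Finset.sum_comm
  have f2 : ∑ μ, ∑ α, ∑ β, ∑ l, S l β * (Γ μ β α * Γ' α μ l) =
      ∑ l, ∑ β, ∑ μ, ∑ α, S l β * (Γ μ β α * Γ' α μ l) := by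
    calc _ = ∑ μ, ∑ α, ∑ l, ∑ β, S l β * (Γ μ β α * Γ' α μ l) :=
          Finset.sum_congr rfl fun _ _ => Finset.sum_congr rfl fun _ _ => Finset.sum_comm
      _ = ∑ μ, ∑ l, ∑ α, ∑ β, S l β * (Γ μ β α * Γ' α μ l) :=
          Finset.sum_congr rfl fun _ _ => Finset.sum_comm
      _ = ∑ l, ∑ μ, ∑ α, ∑ β, S l β * (Γ μ β α * Γ' α μ l) := Finset.sum_comm
      _ = ∑ l, ∑ μ, ∑ β, ∑ α, S l β * (Γ μ β α * Γ' α μ l) :=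
          Finset.sum_congr rfl fun _ _ => Finset.sum_congr rfl fun _ _ => Finset.sum_comm
      _ = _ := Finset.sum_congr rfl fun _ _ => Finset.sum_comm
  have f3 : ∑ μ, ∑ α, ∑ β, ∑ l, S α l * (Γ' β l μ * Γ μ β α) =
      ∑ α, ∑ l, ∑ β, ∑ μ, S α l * (Γ' β l μ * Γ μ β α) := by
    calc _ = ∑ α, ∑ μ, ∑ β, ∑ l, S α l * (Γ' β l μ * Γ μ β α) := Finset.sum_comm
      _ = ∑ α, ∑ μ, ∑ l, ∑ β, S α l * (Γ' β l μ * Γ μ β α) :=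
          Finset.sum_congr rfl fun _ _ => Finset.sum_congr rfl fun _ _ => Finset.sum_comm
      _ = ∑ α, ∑ l, ∑ μ, ∑ β, S α l * (Γ' β l μ * Γ μ β α) :=
          Finset.sum_congr rfl fun _ _ => Finset.sum_comm
      _ = _ := Finset.sum_congr rfl fun _ _ => Finset.sum_congr rfl fun _ _ => Finset.sum_comm
  have f4 : ∑ μ, ∑ α, ∑ l, S l μ * (Γ' α μ l * conTrace Γ α) =
      ∑ l, ∑ μ, ∑ α, S l μ * (Γ' α μ l * conTrace Γ α) := by
    calc _ = ∑ μ, ∑ l, ∑ α, S l μ * (Γ' α μ l * conTrace Γ α) :=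
          Finset.sum_congr rfl fun _ _ => Finset.sum_comm
      _ = _ := Finset.sum_comm
  rw [f1, f2, f3, f4]
  ring

/-! ### Calculus of the metric -/

section Smooth

variable {n : ℕ∞}

lemma contDiff_det {E ι : Type*} [NormedAddCommGroup E] [NormedSpace ℝ E] [Fintype ι]
    [DecidableEq ι] {M : E → Matrix ι ι ℝ} (hM : ∀ i j, ContDiff ℝ n fun x => M x i j) :
    ContDiff ℝ n fun x => (M x).det := by
  simp only [Matrix.det_apply]
  exact ContDiff.sum fun σ _ => (contDiff_prod fun i _ => hM _ _).const_smul _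

lemma contDiff_gMat_apply (α β : Fin 4) : ContDiff ℝ n fun g : Met => gMat g α β := by
  simp only [gMat, Matrix.of_apply]
  fun_prop

lemma contDiff_gMat_det : ContDiff ℝ n fun g : Met => (gMat g).det :=
  contDiff_det contDiff_gMat_apply

/-- By Cramer's rule an entry of the inverse is a ratio of polynomials in the `g_{αβ}`. -/
lemma contDiffAt_gInv {g : Met} (hg : (gMat g).det ≠ 0) (α β : Fin 4) :
    ContDiffAt ℝ n (fun g : Met => gInv g α β) g := by
  have h : (fun g : Met => gInv g α β) =
      fun g => (gMat g).det⁻¹ * ((gMat g).updateRow β (Pi.single α 1)).det := by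
    ext g
    simp [gInv, Matrix.inv_def, Matrix.adjugate_apply]
  rw [h]
  refine (contDiff_gMat_det.contDiffAt.inv hg).mul (ContDiff.contDiffAt (contDiff_det ?_))
  intro i j
  by_cases hi : i = β
  · subst hi
    simpa using contDiff_const
  · simpa [hi] using contDiff_gMat_apply i j

lemma contDiffAt_rho {g : Met} (hg : (gMat g).det ≠ 0) : ContDiffAt ℝ n rho g :=
  (contDiff_gMat_det.contDiffAt.abs hg).sqrt (abs_ne_zero.2 hg)

end Smooth

/-- The densitised inverse metric `ϱ g^{αβ}`. -/
def densInv (g : Met) (α β : Fin 4) : ℝ := rho g * gInv g α β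

lemma contDiffAt_densInv {n : ℕ∞} {g : Met} (hg : (gMat g).det ≠ 0) (α β : Fin 4) :
    ContDiffAt ℝ n (fun g => densInv g α β) g :=
  (contDiffAt_rho hg).mul (contDiffAt_gInv hg α β)

lemma isOpen_det_ne_zero : IsOpen {g : Met | (gMat g).det ≠ 0} :=
  isOpen_ne_fun (contDiff_gMat_det (n := 0)).continuous continuous_const

lemma gMat_apply (g : Met) (α β : Fin 4) : gMat g α β = g s(α, β) := rfl

lemma gMat_transpose (g : Met) : (gMat g).transpose = gMat g := by
  ext α β
  simp [gMat_apply, Sym2.eq_swap]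

lemma gInv_comm (g : Met) (α β : Fin 4) : gInv g α β = gInv g β α := by
  conv_lhs => rw [gInv, ← gMat_transpose, ← Matrix.transpose_nonsing_inv]
  rfl

lemma densInv_comm (g : Met) (α β : Fin 4) : densInv g α β = densInv g β α := by
  rw [densInv, gInv_comm, densInv]

lemma one_apply_eq_delta (α β : Fin 4) : (1 : Matrix (Fin 4) (Fin 4) ℝ) α β = delta α β :=
  Matrix.one_apply

lemma gInv_mul_gMat {g : Met} (hg : (gMat g).det ≠ 0) : gInv g * gMat g = 1 :=
  Matrix.nonsing_inv_mul _ (Ne.isUnit hg)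

lemma gMat_mul_gInv {g : Met} (hg : (gMat g).det ≠ 0) : gMat g * gInv g = 1 :=
  Matrix.mul_nonsing_inv _ (Ne.isUnit hg)

lemma sum_gInv_mul {g : Met} (hg : (gMat g).det ≠ 0) (α β : Fin 4) :
    ∑ k, gInv g α k * g s(k, β) = delta α β := by
  rw [← one_apply_eq_delta, ← gInv_mul_gMat hg, Matrix.mul_apply]
  rfl

lemma sum_mul_gInv {g : Met} (hg : (gMat g).det ≠ 0) (α β : Fin 4) :
    ∑ k, g s(α, k) * gInv g k β = delta α β := by
  rw [← one_apply_eq_delta, ← gMat_mul_gInv hg, Matrix.mul_apply]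
  rfl

lemma sum_mul_sum_gInv {g : Met} (hg : (gMat g).det ≠ 0) (α : Fin 4)
    (f : Fin 4 → ℝ) :
    ∑ k, g s(α, k) * ∑ l, gInv g k l * f l = f α := by
  simp only [Finset.mul_sum, ← mul_assoc]
  rw [Finset.sum_comm]
  simp only [← Finset.sum_mul, sum_mul_gInv hg, sum_delta_mul]

lemma sum_gInv_mul_sum {g : Met} (hg : (gMat g).det ≠ 0) (α : Fin 4)
    (f : Fin 4 → ℝ) :
    ∑ k, gInv g α k * ∑ l, g s(k, l) * f l = f α := by
  simp only [Finset.mul_sum, ← mul_assoc]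
  rw [Finset.sum_comm]
  simp only [← Finset.sum_mul, sum_gInv_mul hg, sum_delta_mul]

lemma christoffel_comm (g : Met) (v : Fin 4 → Met) (μ α γ : Fin 4) :
    christoffel g v μ α γ = christoffel g v μ γ α := by
  simp only [christoffel]
  congr 1
  refine Finset.sum_congr rfl fun ν _ => ?_
  rw [Sym2.eq_swap (a := α) (b := γ)]
  ring

/-- The Levi-Civita connection is metric. -/
lemma christoffel_metric {g : Met} (hg : (gMat g).det ≠ 0) (v : Fin 4 → Met) (μ α β : Fin 4) :
    v μ s(α, β) = ∑ l, g s(α, l) * christoffel g v l μ β +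
      ∑ l, g s(β, l) * christoffel g v l μ α := by
  have h : ∀ α β, ∑ l, g s(α, l) * christoffel g v l μ β =
      (1 / 2) * (v μ s(α, β) + v β s(α, μ) - v α s(μ, β)) := by
    intro α β
    rw [← sum_mul_sum_gInv hg α fun ν => (v μ s(ν, β) + v β s(ν, μ) - v ν s(μ, β)),
      Finset.mul_sum]
    exact Finset.sum_congr rfl fun l _ => by rw [christoffel]; ring
  rw [h, h, Sym2.eq_swap (a := β) (b := α), Sym2.eq_swap (a := μ) (b := β),
    Sym2.eq_swap (a := α) (b := μ)]
  ring

/-- A torsion-free metric connection is the Levi-Civita connection. -/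
lemma christoffel_unique {g : Met} (hg : (gMat g).det ≠ 0) {v : Fin 4 → Met} {Γ : Con}
    (hΓ : ∀ a b c, Γ a b c = Γ a c b)
    (hv : ∀ μ α β, v μ s(α, β) = ∑ l, g s(α, l) * Γ l μ β + ∑ l, g s(β, l) * Γ l μ α) :
    christoffel g v = Γ := by
  ext μ α γ
  rw [← sum_gInv_mul_sum hg μ fun l => Γ l α γ, christoffel, Finset.mul_sum]
  refine Finset.sum_congr rfl fun ν _ => ?_
  rw [hv, hv, hv]
  simp only [hΓ _ γ α, hΓ _ γ ν, hΓ _ α ν]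
  ring

/-- Jacobi's formula at the identity: `det (1 + tM) = 1 + t tr M + t² P(t)` with `P` a polynomial.
-/
lemma hasDerivAt_det_one_add_smul (g h : Met) :
    HasDerivAt (fun t : ℝ => (1 + t • (gInv g * gMat h)).det) (gInv g * gMat h).trace 0 := by
  rw [funext fun t : ℝ => Matrix.det_one_add_smul t (gInv g * gMat h)]
  set P := (Matrix.det (1 + (Polynomial.X : Polynomial ℝ) •
    (gInv g * gMat h).map Polynomial.C)).divX.divX
  have h1 : HasDerivAt (fun t : ℝ => 1 + (gInv g * gMat h).trace * t)
      ((gInv g * gMat h).trace * 1) 0 := ((hasDerivAt_id 0).const_mul _).const_add 1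
  have h2 : HasDerivAt (fun t : ℝ => P.eval t * t ^ 2) _ 0 :=
    (P.hasDerivAt 0).mul (hasDerivAt_pow 2 0)
  exact (h1.add h2).congr_deriv (by simp)

lemma gMat_add_smul (g h : Met) (t : ℝ) : gMat (g + t • h) = gMat g + t • gMat h := by
  ext α β
  simp [gMat]

/-- Factor `g + t h = g (1 + t g⁻¹ h)`. The second determinant is positive for small `t`, so the
absolute value does not affect its derivative; then `|det g| = ϱ²`. -/
lemma fderiv_rho {g : Met} (hg : (gMat g).det ≠ 0) (h : Met) :
    fderiv ℝ rho g h = 1 / 2 * rho g * (gInv g * gMat h).trace := by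
  have h0 := (((contDiffAt_rho (n := 1) hg).differentiableAt (by simp)).hasFDerivAt).hasLineDerivAt
    h
  have h1 : (fun t : ℝ => rho (g + t • h)) =
      fun t => Real.sqrt (|(gMat g).det| * |(1 + t • (gInv g * gMat h)).det|) := by
    ext t
    rw [rho, gMat_add_smul, ← abs_mul, ← Matrix.det_mul, mul_add, Matrix.mul_smul,
      ← Matrix.mul_assoc, gMat_mul_gInv hg]
    simp
  have h2 := hasDerivAt_det_one_add_smul g h
  have h3 : HasDerivAt (fun t : ℝ => |(1 + t • (gInv g * gMat h)).det|)
      (gInv g * gMat h).trace 0 := by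
    refine h2.congr_of_eventuallyEq ?_
    have h : ∀ᶠ t : ℝ in 𝓝 0, 0 < (1 + t • (gInv g * gMat h)).det :=
      h2.continuousAt.eventually (lt_mem_nhds (by simp))
    filter_upwards [h] with t ht using abs_of_pos ht
  have h4 := (h3.const_mul |(gMat g).det|).sqrt (by simpa using hg)
  rw [← h1] at h4
  rw [h0.unique (show HasLineDerivAt ℝ rho _ g h from h4)]
  have h6 : |(gMat g).det| = rho g * rho g := (Real.mul_self_sqrt (abs_nonneg _)).symm
  have h7 : rho g ≠ 0 := Real.sqrt_ne_zero'.2 (abs_pos.2 hg)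
  simp only [zero_smul, add_zero, Matrix.det_one, abs_one, mul_one]
  change _ / (2 * rho g) = _
  rw [h6]
  field_simp

/-- Differentiate `g⁻¹ g = 1`, valid on a neighbourhood of `g`, and multiply on the right by `g⁻¹`.
-/
lemma fderiv_gInv {g : Met} (hg : (gMat g).det ≠ 0) (h : Met) (α β : Fin 4) :
    fderiv ℝ (fun g => gInv g α β) g h =
      -∑ k, ∑ l, gInv g α k * h s(k, l) * gInv g l β := by
  have hd : ∀ α β, DifferentiableAt ℝ (fun g => gInv g α β) g := fun α β =>
    (contDiffAt_gInv (n := 1) hg α β).differentiableAt (by simp)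
  have hp : ∀ p : Sym2 (Fin 4), HasFDerivAt (fun g : Met => g p)
    (ContinuousLinearMap.proj (R := ℝ) (φ := fun _ : Sym2 (Fin 4) => ℝ) p) g := fun p =>
    (ContinuousLinearMap.proj (R := ℝ) (φ := fun _ : Sym2 (Fin 4) => ℝ) p).hasFDerivAt
  have h1 : ∀ γ, ∑ k, (fderiv ℝ (fun g => gInv g α k) g h * g s(k, γ) +
      gInv g α k * h s(k, γ)) = 0 := by
    intro γ
    have e : (fun g : Met => ∑ k, gInv g α k * g s(k, γ)) =ᶠ[𝓝 g] fun _ => delta α γ := by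
      filter_upwards [isOpen_det_ne_zero.mem_nhds hg] with g' hg'
      exact sum_gInv_mul hg' α γ
    have h2 := HasFDerivAt.fun_sum (u := Finset.univ) fun k _ =>
      (hd α k).hasFDerivAt.mul (hp s(k, γ))
    have h3 := (h2.congr_of_eventuallyEq e.symm).unique (hasFDerivAt_const _ _)
    have h4 := congrArg (fun l : Met →L[ℝ] ℝ => l h) h3
    simp only [sum_apply, add_apply,
      smul_apply, ContinuousLinearMap.proj_apply, smul_eq_mul,
      zero_apply] at h4
    rw [← h4]
    exact Finset.sum_congr rfl fun k _ => by ring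
  have h5 : ∑ γ, (∑ k, fderiv ℝ (fun g => gInv g α k) g h * g s(k, γ)) * gInv g γ β =
      fderiv ℝ (fun g => gInv g α β) g h := by
    simp only [Finset.sum_mul, mul_assoc]
    rw [Finset.sum_comm]
    simp only [← Finset.mul_sum, sum_mul_gInv hg, sum_mul_delta']
  have h6 : ∀ γ, ∑ k, fderiv ℝ (fun g => gInv g α k) g h * g s(k, γ) =
      -∑ k, gInv g α k * h s(k, γ) := fun γ => by
    have := h1 γ
    rw [Finset.sum_add_distrib] at this
    linarith
  rw [← h5]
  simp only [h6, neg_mul, Finset.sum_neg_distrib, Finset.sum_mul]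
  rw [Finset.sum_comm]

lemma fderiv_densInv {g : Met} (hg : (gMat g).det ≠ 0) (h : Met) (α β : Fin 4) :
    fderiv ℝ (fun g => densInv g α β) g h =
      rho g * (1 / 2 * (gInv g * gMat h).trace * gInv g α β -
        ∑ k, ∑ l, gInv g α k * h s(k, l) * gInv g l β) := by
  have h1 : DifferentiableAt ℝ rho g := (contDiffAt_rho (n := 1) hg).differentiableAt (by simp)
  have h2 : DifferentiableAt ℝ (fun g => gInv g α β) g :=
    (contDiffAt_gInv (n := 1) hg α β).differentiableAt (by simp)
  have h3 := (h1.hasFDerivAt.mul h2.hasFDerivAt).fderiv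
  change fderiv ℝ (rho * fun g => gInv g α β) g h = _
  rw [h3]
  simp only [add_apply, smul_apply, smul_eq_mul,
    fderiv_rho hg, fderiv_gInv hg]
  ring

lemma fderiv_densInv_comm (g h : Met) (α β : Fin 4) :
    fderiv ℝ (fun g => densInv g α β) g h = fderiv ℝ (fun g => densInv g β α) g h := by
  simp only [densInv_comm _ α β]

/-- The densitised inverse metric is parallel for the Levi-Civita connection. -/
lemma fderiv_densInv_parallel {g : Met} (hg : (gMat g).det ≠ 0) (v : Fin 4 → Met)
    (μ α β : Fin 4) :
    fderiv ℝ (fun g => densInv g α β) g (v μ) =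
      densInv g α β * conTrace (christoffel g v) μ
        - ∑ l, christoffel g v α μ l * densInv g l β
        - ∑ l, christoffel g v β μ l * densInv g α l := by
  -- Metricity with one index raised. Its trace gives `htr`, and raising the other index gives
  -- `hraise`.
  have hup : ∀ α β, ∑ k, gInv g α k * v μ s(k, β) =
      christoffel g v α μ β + ∑ k, ∑ l, gInv g α k * (g s(β, l) * christoffel g v l μ k) := by
    intro α β
    rw [← sum_gInv_mul_sum hg α fun l => christoffel g v l μ β, ← Finset.sum_add_distrib]
    refine Finset.sum_congr rfl fun k _ => ?_
    rw [christoffel_metric hg v μ k β, mul_add, Finset.mul_sum (a := gInv g α k)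
      (f := fun l => g s(β, l) * christoffel g v l μ k)]
  have htr : (gInv g * gMat (v μ)).trace = 2 * conTrace (christoffel g v) μ := by
    have e1 : (gInv g * gMat (v μ)).trace = ∑ α, ∑ k, gInv g α k * v μ s(k, α) := by
      simp [Matrix.trace, Matrix.mul_apply, gMat_apply]
    have e2 : ∑ α, ∑ k, ∑ l, gInv g α k * (g s(α, l) * christoffel g v l μ k) =
        conTrace (christoffel g v) μ := by
      calc _ = ∑ k, ∑ α, gInv g k α * ∑ l, g s(α, l) * christoffel g v l μ k := by
            rw [Finset.sum_comm]
            simp only [Finset.mul_sum]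
            refine Finset.sum_congr rfl fun k _ => Finset.sum_congr rfl fun α _ =>
              Finset.sum_congr rfl fun l _ => ?_
            rw [gInv_comm g α k]
        _ = _ := by
          simp only [sum_gInv_mul_sum hg, conTrace]
          exact Finset.sum_congr rfl fun k _ => christoffel_comm _ _ _ _ _
    simp only [e1, hup, Finset.sum_add_distrib, e2, conTrace]
    have : ∀ α, christoffel g v α μ α = christoffel g v α α μ := fun α => christoffel_comm _ _ _ _ _
    simp only [this]
    ring
  have hraise : ∑ k, ∑ l, gInv g α k * v μ s(k, l) * gInv g l β =
      ∑ l, christoffel g v α μ l * gInv g l β + ∑ l, christoffel g v β μ l * gInv g α l := by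
    rw [Finset.sum_comm]
    simp only [← Finset.sum_mul, hup, add_mul, Finset.sum_add_distrib]
    congr 1
    have e : ∀ x, (∑ k, ∑ l, gInv g α k * (g s(x, l) * christoffel g v l μ k)) * gInv g x β =
        ∑ k, gInv g α k * (gInv g β x * ∑ l, g s(x, l) * christoffel g v l μ k) := by
      intro x
      simp only [Finset.sum_mul, Finset.mul_sum, gInv_comm g x β]
      exact Finset.sum_congr rfl fun k _ => Finset.sum_congr rfl fun l _ => by ring
    simp only [e]
    rw [Finset.sum_comm]
    simp only [← Finset.mul_sum, sum_gInv_mul_sum hg]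
    exact Finset.sum_congr rfl fun l _ => mul_comm _ _
  rw [fderiv_densInv hg, htr, hraise]
  simp only [densInv, mul_sub, mul_add, Finset.mul_sum, sub_sub]
  congr 1
  · ring
  · congr 1 <;> exact Finset.sum_congr rfl fun l _ => by ring

/-! ### The first-order Einstein–Hilbert Lagrangian -/

lemma sum_sym2 {M : Type*} [AddCommMonoid M] (f : Sym2 (Fin 4) → M) :
    ∑ p, f p = ∑ α, ∑ β ∈ Finset.Ici α, f s(α, β) := by
  rw [Finset.sum_sigma']
  symm
  refine Finset.sum_nbij (fun x => s(x.1, x.2)) (fun _ _ => Finset.mem_univ _) ?_ ?_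
    fun _ _ => rfl
  · rintro ⟨a, b⟩ h ⟨c, d⟩ h' e
    simp only [Finset.coe_sigma, Set.mem_sigma_iff, Finset.mem_coe, Finset.mem_Ici,
      Finset.mem_univ, true_and] at h h'
    rcases Sym2.eq_iff.1 e with ⟨h1, h2⟩ | ⟨h1, h2⟩
    · simp_all
    · simp only at h1 h2
      subst h1 h2
      have := le_antisymm h h'
      subst this
      rfl
  · intro p _
    induction p using Sym2.ind with
    | _ a b =>
      rcases le_total a b with h | h
      · exact ⟨⟨a, b⟩, by simpa using h, rfl⟩
      · exact ⟨⟨b, a⟩, by simpa using h, Sym2.eq_swap⟩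

lemma sum_nFactor {f : Fin 4 → Fin 4 → ℝ} (hf : ∀ α β, f α β = f β α) :
    ∑ α, ∑ β ∈ Finset.Ici α, nFactor α β * f α β = ∑ α, ∑ β, f α β := by
  have h0 : Finset.Ici (0 : Fin 4) = {0, 1, 2, 3} := by decide
  have h1 : Finset.Ici (1 : Fin 4) = {1, 2, 3} := by decide
  have h2 : Finset.Ici (2 : Fin 4) = {2, 3} := by decide
  have h3 : Finset.Ici (3 : Fin 4) = {3} := by decide
  simp only [Fin.sum_univ_four, h0, h1, h2, h3]
  simp [nFactor]
  linear_combination hf 0 1 + hf 0 2 + hf 0 3 + hf 1 2 + hf 1 3 + hf 2 3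

/-- The pairs `l ≤ s` index a basis of `Met`, so these partial derivatives assemble into a
directional derivative. -/
lemma sum_partialMet (f : Met → ℝ) (g h : Met) :
    ∑ l, ∑ s ∈ Finset.Ici l, h s(l, s) * partialMet f l s g = fderiv ℝ f g h := by
  have e : h = ∑ p, h p • (Pi.single p 1 : Met) := by
    ext q
    simp [Finset.sum_apply, Pi.single_apply]
  conv_rhs => rw [e]
  rw [map_sum, sum_sym2]
  simp only [map_smul, smul_eq_mul]
  rfl

/-- The weights `nFactor` turn the sum over `α ≤ β` into a full sum. The result is the boundary
vector density of the Levi-Civita connection, so the term subtracted in `lagBar` becomes a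
derivative of that density in the metric (`sum_partial_lagCoeff`). -/
lemma sum_lagCoeff (g : Met) (v : Fin 4 → Met) (ν : Fin 4) :
    ∑ α, ∑ β ∈ Finset.Ici α, ∑ μ, v μ s(α, β) * lagCoeff α β μ ν g =
      conPair (densInv g) (christoffel g v) ν := by
  have h1 : ∀ α β, ∑ μ, v μ s(α, β) * lagCoeff α β μ ν g = nFactor α β *
      (rho g / 2 * ∑ μ, v μ s(α, β) * (gInv g α μ * gInv g β ν + gInv g α ν * gInv g β μ -
        2 * gInv g α β * gInv g μ ν)) := by
    intro α β
    rw [Finset.mul_sum, Finset.mul_sum]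
    exact Finset.sum_congr rfl fun μ _ => by rw [lagCoeff]; ring
  simp only [h1]
  rw [sum_nFactor]
  swap
  · intro α β
    rw [Sym2.eq_swap, gInv_comm g β α]
    congr 1
    exact Finset.sum_congr rfl fun μ _ => by ring
  simp only [conPair_eq, densInv, christoffel, conTrace]
  have e1 : ∑ α, ∑ β, rho g * gInv g α β *
        (1 / 2 * ∑ l, gInv g ν l * (v β s(l, α) + v α s(l, β) - v l s(β, α))) =
      rho g / 2 * (∑ α, ∑ β, ∑ μ, v μ s(α, β) * (gInv g α ν * gInv g β μ) +
        ∑ α, ∑ β, ∑ μ, v μ s(α, β) * (gInv g α μ * gInv g β ν) -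
        ∑ α, ∑ β, ∑ μ, v μ s(α, β) * (gInv g α β * gInv g μ ν)) := by
    have t1 : ∑ α, ∑ β, ∑ μ, v μ s(α, β) * (gInv g α ν * gInv g β μ) =
        ∑ α, ∑ β, ∑ l, gInv g α β * (gInv g ν l * v β s(l, α)) := by
      rw [Finset.sum_comm]
      rw [Finset.sum_congr rfl fun _ _ => Finset.sum_comm]
      refine Finset.sum_congr rfl fun α _ => Finset.sum_congr rfl fun β _ =>
        Finset.sum_congr rfl fun l _ => ?_
      rw [gInv_comm g ν l]
      ring
    have t2 : ∑ α, ∑ β, ∑ μ, v μ s(α, β) * (gInv g α μ * gInv g β ν) =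
        ∑ α, ∑ β, ∑ l, gInv g α β * (gInv g ν l * v α s(l, β)) := by
      rw [Finset.sum_congr rfl fun _ _ => Finset.sum_comm]
      rw [Finset.sum_comm]
      refine Finset.sum_congr rfl fun α _ => Finset.sum_congr rfl fun β _ =>
        Finset.sum_congr rfl fun l _ => ?_
      rw [gInv_comm g ν l, Sym2.eq_swap, gInv_comm g α β]
      ring
    have t3 : ∑ α, ∑ β, ∑ μ, v μ s(α, β) * (gInv g α β * gInv g μ ν) =
        ∑ α, ∑ β, ∑ l, gInv g α β * (gInv g ν l * v l s(β, α)) := by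
      refine Finset.sum_congr rfl fun α _ => Finset.sum_congr rfl fun β _ =>
        Finset.sum_congr rfl fun l _ => ?_
      rw [gInv_comm g ν l, Sym2.eq_swap]
      ring
    rw [t1, t2, t3]
    simp only [← Finset.sum_add_distrib, ← Finset.sum_sub_distrib, Finset.mul_sum]
    refine Finset.sum_congr rfl fun α _ => Finset.sum_congr rfl fun β _ =>
        Finset.sum_congr rfl fun l _ => by ring
  have e2 : ∑ α, rho g * gInv g α ν *
        ∑ γ, 1 / 2 * ∑ l, gInv g γ l * (v γ s(l, α) + v α s(l, γ) - v l s(γ, α)) =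
      rho g / 2 * ∑ α, ∑ β, ∑ μ, v μ s(α, β) * (gInv g α β * gInv g μ ν) := by
    have t0 : ∀ α, ∑ γ, ∑ l, gInv g γ l * v γ s(l, α) = ∑ γ, ∑ l, gInv g γ l * v l s(γ, α) := by
      intro α
      rw [Finset.sum_comm]
      exact Finset.sum_congr rfl fun γ _ => Finset.sum_congr rfl fun l _ => by
        rw [gInv_comm g l γ]
    have t1 : ∀ α, ∑ γ, 1 / 2 * ∑ l, gInv g γ l * (v γ s(l, α) + v α s(l, γ) - v l s(γ, α)) =
        1 / 2 * ∑ γ, ∑ l, gInv g γ l * v α s(l, γ) := by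
      intro α
      have := t0 α
      simp only [mul_sub, mul_add, Finset.sum_add_distrib, Finset.sum_sub_distrib,
        ← Finset.mul_sum] at this ⊢
      linarith
    simp only [t1]
    simp only [Finset.mul_sum]
    conv_rhs =>
      rw [Finset.sum_congr rfl fun _ _ => Finset.sum_comm]
      rw [Finset.sum_comm]
      rw [Finset.sum_congr rfl fun _ _ => Finset.sum_comm]
    refine Finset.sum_congr rfl fun α _ => Finset.sum_congr rfl fun β _ =>
        Finset.sum_congr rfl fun l _ => ?_
    rw [gInv_comm g β l]
    ring
  rw [e1, e2]
  simp only [mul_add, mul_sub, Finset.sum_add_distrib, Finset.sum_sub_distrib, ← Finset.mul_sum]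
  have e3 : ∑ α, ∑ β, ∑ μ, v μ s(α, β) * (2 * gInv g α β * gInv g μ ν) =
      2 * ∑ α, ∑ β, ∑ μ, v μ s(α, β) * (gInv g α β * gInv g μ ν) := by
    simp only [Finset.mul_sum]
    exact Finset.sum_congr rfl fun α _ => Finset.sum_congr rfl fun β _ =>
        Finset.sum_congr rfl fun l _ => by ring
  rw [e3]
  ring

lemma contDiffAt_christoffel {n : ℕ∞} {q : Met × (Fin 4 → Met)} (hq : (gMat q.1).det ≠ 0)
    (μ α γ : Fin 4) :
    ContDiffAt ℝ n (fun q : Met × (Fin 4 → Met) => christoffel q.1 q.2 μ α γ) q := by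
  unfold christoffel
  refine contDiffAt_const.mul (ContDiffAt.sum fun ν _ => ContDiffAt.mul ?_ ?_)
  · exact (contDiffAt_gInv hq μ ν).comp q contDiffAt_fst
  · fun_prop

lemma differentiableAt_christoffel {g : Met} (hg : (gMat g).det ≠ 0) (v : Fin 4 → Met)
    (μ α γ : Fin 4) : DifferentiableAt ℝ (fun g => christoffel g v μ α γ) g :=
  ((contDiffAt_christoffel (n := 1) (q := (g, v)) hg μ α γ).comp g
    (f := fun g => (g, v)) (contDiffAt_id.prodMk contDiffAt_const)).differentiableAt (by simp)

/-- The derivative of the Levi-Civita connection in a direction `h` of the metric, with the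
derivatives of the metric held fixed. -/
def christoffelVar (g : Met) (v : Fin 4 → Met) (h : Met) : Con := fun μ α γ =>
  -∑ k, gInv g μ k * ∑ l, h s(k, l) * christoffel g v l α γ

lemma fderiv_christoffel {g : Met} (hg : (gMat g).det ≠ 0) (v : Fin 4 → Met) (h : Met)
    (μ α γ : Fin 4) :
    fderiv ℝ (fun g => christoffel g v μ α γ) g h = christoffelVar g v h μ α γ := by
  have hd : ∀ ν, HasFDerivAt (fun g => gInv g μ ν * (v α s(ν, γ) + v γ s(ν, α) - v ν s(α, γ)))
      ((v α s(ν, γ) + v γ s(ν, α) - v ν s(α, γ)) • fderiv ℝ (fun g => gInv g μ ν) g) g := fun ν =>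
    ((contDiffAt_gInv (n := 1) hg μ ν).differentiableAt (by simp)).hasFDerivAt.mul_const _
  have h1 := ((HasFDerivAt.fun_sum (u := Finset.univ) fun ν _ => hd ν).const_mul (1 / 2)).fderiv
  change fderiv ℝ (fun g => 1 / 2 * ∑ ν, gInv g μ ν * _) g h = _
  rw [h1]
  simp only [smul_apply, sum_apply, fderiv_gInv hg, smul_eq_mul, christoffelVar, christoffel,
    Finset.mul_sum, mul_neg, Finset.sum_neg_distrib]
  congr 1
  rw [Finset.sum_comm]
  refine Finset.sum_congr rfl fun k _ => ?_
  rw [Finset.sum_comm]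
  exact Finset.sum_congr rfl fun l _ => Finset.sum_congr rfl fun ν _ => by ring

lemma fderiv_conPair_christoffel {g : Met} (hg : (gMat g).det ≠ 0) (v : Fin 4 → Met) (h : Met)
    (ν : Fin 4) :
    fderiv ℝ (fun g => conPair (densInv g) (christoffel g v) ν) g h =
      conPair (fun α β => fderiv ℝ (fun g => densInv g α β) g h) (christoffel g v) ν +
        conPair (densInv g) (christoffelVar g v h) ν := by
  have hS : ∀ α β, HasFDerivAt (fun g => densInv g α β) (fderiv ℝ (fun g => densInv g α β) g) g :=
    fun α β => ((contDiffAt_densInv (n := 1) hg α β).differentiableAt (by simp)).hasFDerivAt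
  have hC : ∀ a b c, HasFDerivAt (fun g => christoffel g v a b c)
      (fderiv ℝ (fun g => christoffel g v a b c) g) g :=
    fun a b c => (differentiableAt_christoffel hg v a b c).hasFDerivAt
  have h1 : HasFDerivAt (fun g => conPair (densInv g) (christoffel g v) ν) _ g :=
    HasFDerivAt.fun_sum (u := Finset.univ) fun α _ =>
      HasFDerivAt.fun_sum (u := Finset.univ) fun β _ =>
        (hS α β).mul ((hC ν β α).sub
          ((HasFDerivAt.fun_sum (u := Finset.univ) fun γ _ => hC γ γ α).const_mul (delta ν β)))
  rw [h1.fderiv]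
  simp only [sum_apply, add_apply, smul_apply, sub_apply, smul_eq_mul, fderiv_christoffel hg,
    conPair, conTrace, ← Finset.sum_add_distrib]
  exact Finset.sum_congr rfl fun α _ => Finset.sum_congr rfl fun β _ => by ring

lemma contDiffAt_lagCoeff {n : ℕ∞} {g : Met} (hg : (gMat g).det ≠ 0) (α β μ ν : Fin 4) :
    ContDiffAt ℝ n (lagCoeff α β μ ν) g := by
  have h := fun α β => contDiffAt_gInv (n := n) hg α β
  exact (contDiffAt_const.mul (contDiffAt_rho hg)).mul
    ((((h α μ).mul (h β ν)).add ((h α ν).mul (h β μ))).sub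
      ((contDiffAt_const.mul (h α β)).mul (h μ ν)))

lemma sum_partial_lagCoeff {g : Met} (hg : (gMat g).det ≠ 0) (v : Fin 4 → Met) :
    ∑ α, ∑ β ∈ Finset.Ici α, ∑ l, ∑ s ∈ Finset.Ici l, ∑ μ, ∑ ν,
      v μ s(α, β) * v ν s(l, s) * partialMet (lagCoeff α β μ ν) l s g =
    ∑ ν, fderiv ℝ (fun g => conPair (densInv g) (christoffel g v) ν) g (v ν) := by
  have h1 : ∀ ν, fderiv ℝ (fun g => conPair (densInv g) (christoffel g v) ν) g (v ν) =
      ∑ α, ∑ β ∈ Finset.Ici α, ∑ μ, v μ s(α, β) * fderiv ℝ (lagCoeff α β μ ν) g (v ν) := by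
    intro ν
    have h2 := HasFDerivAt.fun_sum (u := Finset.univ) fun α _ =>
      HasFDerivAt.fun_sum (u := Finset.Ici α) fun β _ =>
        HasFDerivAt.fun_sum (u := Finset.univ) fun μ _ =>
          (((contDiffAt_lagCoeff (n := 1) hg α β μ ν).differentiableAt
            (by simp)).hasFDerivAt.const_mul (v μ s(α, β)))
    simp only [sum_lagCoeff] at h2
    rw [h2.fderiv]
    simp only [sum_apply, smul_apply, smul_eq_mul]
  simp only [h1, ← sum_partialMet, Finset.mul_sum]
  conv_rhs => rw [Finset.sum_comm]
  refine Finset.sum_congr rfl fun α _ => ?_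
  conv_rhs => rw [Finset.sum_comm]
  refine Finset.sum_congr rfl fun β _ => ?_
  conv_rhs =>
    rw [Finset.sum_comm]
    rw [Finset.sum_congr rfl fun _ _ => Finset.sum_comm]
    rw [Finset.sum_comm]
  refine Finset.sum_congr rfl fun l _ => ?_
  conv_lhs => rw [Finset.sum_comm]
  refine Finset.sum_congr rfl fun μ _ => ?_
  rw [Finset.sum_comm]
  exact Finset.sum_congr rfl fun ν _ => Finset.sum_congr rfl fun s _ => by ring

/-- The terms of `lagZero` of type `g⁻¹ ∂g Γ̃` are the variation of `Γ̃` at fixed velocities. They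
match the second summand of `fderiv_conPair_christoffel` and will cancel in `lagBar`. -/
lemma lagZero_eq {g : Met} (v : Fin 4 → Met) :
    lagZero g v = ∑ ν, conPair (densInv g) (christoffelVar g v (v ν)) ν +
      ∑ α, ∑ β, densInv g α β * ricciQuad (christoffel g v) (christoffel g v) α β := by
  have h1 : ∑ ν, conPair (densInv g) (christoffelVar g v (v ν)) ν =
      ∑ α, ∑ β, densInv g α β * (∑ γ, christoffelVar g v (v γ) γ β α -
        ∑ γ, christoffelVar g v (v β) γ γ α) := by
    simp only [conPair]
    rw [Finset.sum_comm]
    refine Finset.sum_congr rfl fun α _ => ?_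
    rw [Finset.sum_comm]
    refine Finset.sum_congr rfl fun β _ => ?_
    rw [← Finset.mul_sum, Finset.sum_sub_distrib, sum_delta_mul' β
      (fun ν => conTrace (christoffelVar g v (v ν)) α)]
    rfl
  have h2 : ∀ α β, ∑ γ, ∑ δ, gInv g γ δ *
        ∑ μ, (v β s(δ, μ) * christoffel g v μ α γ - v γ s(δ, μ) * christoffel g v μ α β) =
      ∑ γ, christoffelVar g v (v γ) γ β α - ∑ γ, christoffelVar g v (v β) γ γ α := by
    intro α β
    simp only [christoffelVar, Finset.sum_neg_distrib, Finset.sum_sub_distrib, mul_sub]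
    simp only [christoffel_comm g v _ α]
    ring
  have h3 : ∀ α β, ∑ γ, ∑ δ, (christoffel g v δ α β * christoffel g v γ γ δ -
        christoffel g v δ α γ * christoffel g v γ β δ) =
      ricciQuad (christoffel g v) (christoffel g v) α β := by
    intro α β
    rw [ricciQuad, Finset.sum_comm]
    simp only [Finset.sum_sub_distrib]
    congr 1
    · refine Finset.sum_congr rfl fun γ _ => Finset.sum_congr rfl fun σ _ => ?_
      rw [christoffel_comm g v γ α β]
    · rw [Finset.sum_comm]
      refine Finset.sum_congr rfl fun γ _ => Finset.sum_congr rfl fun σ _ => ?_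
      rw [christoffel_comm g v σ α γ]
      ring
  rw [lagZero, h1]
  simp only [h2, h3, densInv, ← Finset.sum_add_distrib]
  rw [Finset.mul_sum]
  refine Finset.sum_congr rfl fun α _ => ?_
  rw [Finset.mul_sum]
  exact Finset.sum_congr rfl fun β _ => by ring

/-- The polarised quadratic Lagrangian `ϱ g^{αβ} Q_{αβ}(Γ̃(u), Γ̃(u'))`. -/
def quadLag (g : Met) (u u' : Fin 4 → Met) : ℝ :=
  ∑ α, ∑ β, densInv g α β * ricciQuad (christoffel g u) (christoffel g u') α β

/-- Parallelism of `ϱ g^{αβ}` expresses its derivative along `u'` through the symbols of `u'`; the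
algebraic identity `sum_conPair_parallel` does the rest. -/
lemma sum_conPair_fderiv_densInv {g : Met} (hg : (gMat g).det ≠ 0) (u u' : Fin 4 → Met) :
    ∑ μ, conPair (fun α β => fderiv ℝ (fun g => densInv g α β) g (u' μ)) (christoffel g u) μ =
      quadLag g u u' + quadLag g u' u := by
  simp only [fderiv_densInv_parallel hg u']
  rw [sum_conPair_parallel _ _ _ (christoffel_comm g u')]
  simp only [quadLag, mul_add, Finset.sum_add_distrib]

/-- `L̄` is the quadratic `ΓΓ` Lagrangian. -/
lemma lagBar_eq {x : Base} {g : Met} (hg : (gMat g).det ≠ 0) (v : Fin 4 → Met) :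
    lagBar (x, g, v) = -quadLag g v v := by
  have h1 := sum_conPair_fderiv_densInv hg v v
  have h2 := sum_partial_lagCoeff hg v
  simp only [fderiv_conPair_christoffel hg, Finset.sum_add_distrib] at h2
  have h3 := lagZero_eq (g := g) v
  rw [lagBar]
  simp only
  -- With `B` the variation term and `Q` the quadratic one, this reads `(B + Q) - (2Q + B) = -Q`.
  rw [h2, h1, h3]
  unfold quadLag
  ring

lemma christoffel_add_smul (g : Met) (u u' : Fin 4 → Met) (t : ℝ) (a b c : Fin 4) :
    christoffel g (u + t • u') a b c = christoffel g u a b c + t * christoffel g u' a b c := by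
  simp only [christoffel, Finset.mul_sum, ← Finset.sum_add_distrib, Pi.add_apply, Pi.smul_apply,
    smul_eq_mul]
  exact Finset.sum_congr rfl fun ν _ => by ring

lemma conTrace_add_smul {Γ Γ₀ Γ₁ : Con} {t : ℝ}
    (h : ∀ a b c, Γ a b c = Γ₀ a b c + t * Γ₁ a b c) (α : Fin 4) :
    conTrace Γ α = conTrace Γ₀ α + t * conTrace Γ₁ α := by
  simp only [conTrace, h, Finset.sum_add_distrib, Finset.mul_sum]

lemma quadLag_add_smul (g : Met) (u u' : Fin 4 → Met) (t : ℝ) :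
    quadLag g (u + t • u') (u + t • u') =
      quadLag g u u + t * (quadLag g u u' + quadLag g u' u) + t ^ 2 * quadLag g u' u' := by
  simp only [quadLag, ← Finset.sum_add_distrib, Finset.mul_sum]
  refine Finset.sum_congr rfl fun α _ => Finset.sum_congr rfl fun β _ => ?_
  have h : ricciQuad (christoffel g (u + t • u')) (christoffel g (u + t • u')) α β =
      ricciQuad (christoffel g u) (christoffel g u) α β +
      t * (ricciQuad (christoffel g u) (christoffel g u') α β +
        ricciQuad (christoffel g u') (christoffel g u) α β) +
      t ^ 2 * ricciQuad (christoffel g u') (christoffel g u') α β := by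
    simp only [ricciQuad, ← Finset.sum_add_distrib, Finset.mul_sum, christoffel_add_smul]
    exact Finset.sum_congr rfl fun γ _ => Finset.sum_congr rfl fun σ _ => by ring
  rw [h]
  ring

lemma contDiffAt_quadLag {n : ℕ∞} {q : Met × (Fin 4 → Met)} (hq : (gMat q.1).det ≠ 0) :
    ContDiffAt ℝ n (fun q : Met × (Fin 4 → Met) => quadLag q.1 q.2 q.2) q := by
  unfold quadLag ricciQuad
  have h := fun a b c => contDiffAt_christoffel (n := n) hq a b c
  refine ContDiffAt.sum fun α _ => ContDiffAt.sum fun β _ => ContDiffAt.mul ?_ ?_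
  · exact (contDiffAt_densInv hq α β).comp q contDiffAt_fst
  · exact ContDiffAt.sum fun γ _ => ContDiffAt.sum fun σ _ =>
      ((h _ _ _).mul (h _ _ _)).sub ((h _ _ _).mul (h _ _ _))

lemma hasLineDerivAt_quadLag (g : Met) (u u' : Fin 4 → Met) :
    HasLineDerivAt ℝ (fun u => -quadLag g u u) (-(quadLag g u u' + quadLag g u' u)) u u' := by
  unfold HasLineDerivAt
  simp only [quadLag_add_smul]
  have h1 : HasDerivAt (fun t : ℝ => t * (quadLag g u u' + quadLag g u' u)) _ 0 :=
    (hasDerivAt_id (0 : ℝ)).mul_const _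
  have h2 : HasDerivAt (fun t : ℝ => t ^ 2 * quadLag g u' u') _ 0 :=
    (hasDerivAt_pow 2 (0 : ℝ)).mul_const _
  exact ((h1.const_add (quadLag g u u)).add h2).neg.congr_deriv (by simp)

lemma conPair_zero (Γ : Con) (μ : Fin 4) : conPair (fun _ _ => 0) Γ μ = 0 := by
  simp [conPair]

/-- The derivative of `-Q` at `v` is minus its symmetrised polarisation, which
`sum_conPair_fderiv_densInv` rewrites as a sum over `μ`. A velocity concentrated in one direction
keeps a single summand. -/
lemma momentum_lagBar {x : Base} {g : Met} (hg : (gMat g).det ≠ 0) (v : Fin 4 → Met)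
    (μ : Fin 4) (h : Met) :
    momentum lagBar (x, g, v) μ h =
      -conPair (fun α β => fderiv ℝ (fun g => densInv g α β) g h) (christoffel g v) μ := by
  have e : (fun u : Fin 4 → Met => lagBar (x, g, u)) = fun u => -quadLag g u u :=
    funext fun u => lagBar_eq hg u
  have hd : DifferentiableAt ℝ (fun u : Fin 4 → Met => -quadLag g u u) v :=
    ((contDiffAt_quadLag (n := 1) (q := (g, v)) hg).comp v
      (f := fun u => (g, u)) (contDiffAt_const.prodMk contDiffAt_id)).neg.differentiableAt
        (by simp)
  change fderiv ℝ (fun u : Fin 4 → Met => lagBar (x, g, u)) v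
    (Pi.single (M := fun _ : Fin 4 => Met) μ h) = _
  rw [e, (hd.hasFDerivAt.hasLineDerivAt _).unique (hasLineDerivAt_quadLag g v _),
    ← sum_conPair_fderiv_densInv hg, Finset.sum_eq_single μ]
  · rw [Pi.single_eq_same]
  · intro ν _ hν
    rw [Pi.single_eq_of_ne hν]
    simp only [map_zero, conPair_zero]
  · simp

/-- Euler's identity for a quadratic Lagrangian: `p = L - 2L = -L`. -/
lemma extLegendre_lagBar_snd {x : Base} {g : Met} (hg : (gMat g).det ≠ 0) (v : Fin 4 → Met) :
    (extLegendre lagBar (x, g, v)).2 = quadLag g v v := by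
  change lagBar (x, g, v) - ∑ μ, momentum lagBar (x, g, v) μ (v μ) = _
  simp only [momentum_lagBar hg, Finset.sum_neg_distrib, sum_conPair_fderiv_densInv hg,
    lagBar_eq hg]
  ring

/-- The covector `h ↦ -D(ϱ g^{αβ})(h) (Γ̃^μ_{βα} - δ^μ_β Γ̃^γ_{γα})`. -/
def momentumBar (g : Met) (v : Fin 4 → Met) (μ : Fin 4) : Met →L[ℝ] ℝ :=
  -∑ α, ∑ β, (christoffel g v μ β α - delta μ β * conTrace (christoffel g v) α) •
    fderiv ℝ (fun g => densInv g α β) g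

lemma momentum_lagBar_eq {x : Base} {g : Met} (hg : (gMat g).det ≠ 0) (v : Fin 4 → Met) :
    momentum lagBar (x, g, v) = momentumBar g v := by
  ext μ h
  rw [momentum_lagBar hg]
  simp only [momentumBar, conPair, neg_apply, sum_apply, smul_apply, smul_eq_mul]
  congr 1
  exact Finset.sum_congr rfl fun α _ => Finset.sum_congr rfl fun β _ => mul_comm _ _

lemma contDiffAt_momentumBar {n : ℕ∞} {q : Met × (Fin 4 → Met)} (hq : (gMat q.1).det ≠ 0) :
    ContDiffAt ℝ n (fun q : Met × (Fin 4 → Met) => momentumBar q.1 q.2) q := by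
  have h := fun a b c => contDiffAt_christoffel (n := n) hq a b c
  have hS : ∀ α β, ContDiffAt ℝ n
      (fun q : Met × (Fin 4 → Met) => fderiv ℝ (fun g => densInv g α β) q.1) q := fun α β =>
    ((contDiffAt_densInv (n := n + 1) hq α β).fderiv_right (by simp)).comp q contDiffAt_fst
  refine contDiffAt_pi.2 fun μ => ?_
  unfold momentumBar conTrace
  exact ContDiffAt.neg (ContDiffAt.sum fun α _ => ContDiffAt.sum fun β _ =>
    ContDiffAt.smul ((h _ _ _).sub (contDiffAt_const.mul (ContDiffAt.sum fun γ _ => h _ _ _)))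
      (hS _ _))

/-- The extended Legendre map of `L̄` in closed form. -/
def extLegendreBar (j : Jet Met) : EMom Met :=
  ((j.1, j.2.1, momentumBar j.2.1 j.2.2), quadLag j.2.1 j.2.2 j.2.2)

lemma extLegendre_lagBar {j : Jet Met} (hj : (gMat j.2.1).det ≠ 0) :
    extLegendre lagBar j = extLegendreBar j := by
  obtain ⟨x, g, v⟩ := j
  refine Prod.ext ?_ (extLegendre_lagBar_snd hj v)
  change (x, g, momentum lagBar (x, g, v)) = (x, g, momentumBar g v)
  rw [momentum_lagBar_eq hj]

lemma eventually_jet_det {j : Jet Met} (hj : (gMat j.2.1).det ≠ 0) :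
    ∀ᶠ j' : Jet Met in 𝓝 j, (gMat j'.2.1).det ≠ 0 :=
  (continuous_fst.comp continuous_snd).continuousAt.eventually (isOpen_det_ne_zero.mem_nhds hj)

lemma contDiffAt_extLegendreBar {n : ℕ∞} {j : Jet Met} (hj : (gMat j.2.1).det ≠ 0) :
    ContDiffAt ℝ n extLegendreBar j := by
  refine ContDiffAt.prodMk (contDiffAt_fst.prodMk (ContDiffAt.prodMk ?_ ?_)) ?_
  · exact contDiffAt_fst.comp j contDiffAt_snd
  · exact (contDiffAt_momentumBar (q := j.2) hj).comp j contDiffAt_snd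
  · exact (contDiffAt_quadLag (q := j.2) hj).comp j contDiffAt_snd

lemma contDiffAt_extLegendre_lagBar {n : ℕ∞} {j : Jet Met} (hj : (gMat j.2.1).det ≠ 0) :
    ContDiffAt ℝ n (extLegendre lagBar) j := by
  refine (contDiffAt_extLegendreBar hj).congr_of_eventuallyEq ?_
  filter_upwards [eventually_jet_det hj] with j' hj' using extLegendre_lagBar hj'

/-! ### Regularity of `L̄` -/

lemma sum_fderiv_densInv_mul {g : Met} (hg : (gMat g).det ≠ 0) (h : Met)
    (X : Matrix (Fin 4) (Fin 4) ℝ) :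
    ∑ α, ∑ β, fderiv ℝ (fun g => densInv g α β) g h * X β α =
      rho g * (1 / 2 * (gInv g * gMat h).trace * (gInv g * X).trace -
        (gInv g * gMat h * gInv g * X).trace) := by
  have h1 : (gInv g * X).trace = ∑ α, ∑ β, gInv g α β * X β α := by
    simp [Matrix.trace, Matrix.mul_apply]
  have h2 : (gInv g * gMat h * gInv g * X).trace =
      ∑ α, ∑ β, (∑ k, ∑ l, gInv g α k * h s(k, l) * gInv g l β) * X β α := by
    simp only [Matrix.trace, Matrix.mul_apply (M := gInv g * gMat h * gInv g), Matrix.diag]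
    refine Finset.sum_congr rfl fun α _ => Finset.sum_congr rfl fun β _ => ?_
    congr 1
    simp only [Matrix.mul_apply, Finset.sum_mul]
    rw [Finset.sum_comm]
    rfl
  rw [h1, h2]
  simp only [fderiv_densInv hg, Finset.mul_sum, ← Finset.sum_sub_distrib]
  exact Finset.sum_congr rfl fun α _ => Finset.sum_congr rfl fun β _ => by ring

/-- The metric with a given symmetric matrix of components. -/
def metOfMatrix (M : Matrix (Fin 4) (Fin 4) ℝ) : Met :=
  fun p => Sym2.lift ⟨fun α β => M α β + M β α, fun _ _ => add_comm _ _⟩ p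

lemma gMat_metOfMatrix (M : Matrix (Fin 4) (Fin 4) ℝ) :
    gMat (metOfMatrix M) = M + M.transpose := by
  ext α β
  rfl

/-- Nondegeneracy of `g ↦ ϱ g^{αβ}`: the values of its derivative at `g` pair nondegenerately with
symmetric matrices. -/
lemma eq_zero_of_sum_fderiv_densInv {g : Met} (hg : (gMat g).det ≠ 0)
    {X : Matrix (Fin 4) (Fin 4) ℝ} (hX : X.transpose = X)
    (h0 : ∀ h : Met, ∑ α, ∑ β, fderiv ℝ (fun g => densInv g α β) g h * X β α = 0) : X = 0 := by
  have hρ : rho g ≠ 0 := Real.sqrt_ne_zero'.2 (abs_pos.2 hg)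
  have h1 : ∀ h : Met, 1 / 2 * (gInv g * gMat h).trace * (gInv g * X).trace -
      (gInv g * gMat h * gInv g * X).trace = 0 := fun h => by
    have := h0 h
    rw [sum_fderiv_densInv_mul hg] at this
    exact (mul_eq_zero.1 this).resolve_left hρ
  -- Testing with `h = g` gives `(4/2 - 1) tr (g⁻¹ X) = 0`; the coefficient is nonzero because the
  -- dimension is not 2.
  have htr : (gInv g * X).trace = 0 := by
    have := h1 g
    rw [gInv_mul_gMat hg, Matrix.one_mul, Matrix.trace_one] at this
    norm_num at this
    linarith
  ext a b
  -- Conjugating an elementary matrix by `g` cancels both factors `g⁻¹`, so after symmetrisation the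
  -- trace reads off `X a b + X b a`.
  have := h1 (metOfMatrix (gMat g * Matrix.single b a 1 * gMat g))
  rw [htr, mul_zero, zero_sub, neg_eq_zero, gMat_metOfMatrix, Matrix.transpose_mul,
    Matrix.transpose_mul, gMat_transpose, Matrix.transpose_single, mul_add, add_mul, add_mul,
    Matrix.trace_add] at this
  have e : ∀ E : Matrix (Fin 4) (Fin 4) ℝ,
      gInv g * (gMat g * E * gMat g) * gInv g * X = E * X := by
    intro E
    rw [Matrix.mul_assoc (gMat g), ← Matrix.mul_assoc (gInv g), gInv_mul_gMat hg, Matrix.one_mul,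
      Matrix.mul_assoc E, gMat_mul_gInv hg, Matrix.mul_one]
  rw [← Matrix.mul_assoc (gMat g), e, e, Matrix.trace_single_mul, Matrix.trace_single_mul] at this
  have hs : X b a = X a b := congrFun (congrFun hX a) b
  simp only [smul_eq_mul, one_mul, hs] at this
  simpa using (by linarith : X a b = 0)

/-- Regularity of `lagBar`. Vanishing momenta force `2 Γ̃^μ_{αβ} = δ^μ_α t_β + δ^μ_β t_α` with `t`
the trace. Contracting gives `2t = 4t + t`, so `t = 0` and `Γ̃ = 0`, and metricity gives `v = 0`. -/
lemma eq_zero_of_momentumBar {g : Met} (hg : (gMat g).det ≠ 0) {v : Fin 4 → Met}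
    (h : momentumBar g v = 0) : v = 0 := by
  set Γ := christoffel g v with hΓ
  have hX : ∀ μ, (Matrix.of fun α β => 2 * Γ μ α β - delta μ α * conTrace Γ β -
      delta μ β * conTrace Γ α) = 0 := by
    intro μ
    refine eq_zero_of_sum_fderiv_densInv hg ?_ ?_
    · ext α β
      simp only [Matrix.transpose_apply, Matrix.of_apply, hΓ, christoffel_comm g v μ α β]
      ring
    · intro k
      have h1 : momentumBar g v μ k = 0 := by rw [h]; rfl
      simp only [momentumBar, neg_apply, sum_apply, smul_apply, smul_eq_mul, neg_eq_zero] at h1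
      -- The derivative of `densInv` is symmetric in its indices, so only the symmetric part of the
      -- coefficient is detected; adding the equation with `α` and `β` exchanged produces it.
      have h2 := h1
      rw [Finset.sum_comm] at h2
      simp only [fderiv_densInv_comm g k] at h2
      have h3 : ∀ α β, fderiv ℝ (fun g => densInv g α β) g k =
        fderiv ℝ (fun g => densInv g β α) g k := fderiv_densInv_comm g k
      have h4 := congrArg₂ (· + ·) h1 h2
      simp only [← Finset.sum_add_distrib, add_zero] at h4
      rw [← h4]
      refine Finset.sum_congr rfl fun α _ => Finset.sum_congr rfl fun β _ => ?_
      rw [h3 α β]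
      simp only [Matrix.of_apply, hΓ, christoffel_comm g v μ β α]
      ring
  have hX' : ∀ μ α β, 2 * Γ μ α β = delta μ α * conTrace Γ β + delta μ β * conTrace Γ α := by
    intro μ α β
    have := congrFun (congrFun (hX μ) α) β
    simp only [Matrix.of_apply, Matrix.zero_apply] at this
    linarith
  have ht : ∀ β, conTrace Γ β = 0 := by
    intro β
    have h1 : ∑ μ, 2 * Γ μ μ β = 2 * conTrace Γ β := by rw [conTrace, Finset.mul_sum]
    have h2 : ∑ μ, delta μ β * conTrace Γ μ = conTrace Γ β := sum_delta_mul' β _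
    have h3 : ∑ μ : Fin 4, delta μ μ * conTrace Γ β = 4 * conTrace Γ β := by
      simp [delta]
    simp only [hX', Finset.sum_add_distrib, h2, h3] at h1
    linarith
  ext μ p
  induction p using Sym2.ind with
  | _ α β =>
    have hz : ∀ l a b, christoffel g v l a b = 0 := fun l a b => by
      have := hX' l a b
      rw [ht, ht] at this
      simpa using this
    rw [christoffel_metric hg v μ α β]
    simp [hz]

/-! ### The Hamiltonian section of the Einstein–Palatini model -/

/-- The coordinate covector `dΓ^a_{bc}`. -/
def conCoord (a b c : Fin 4) : MetCon →L[ℝ] ℝ :=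
  (ContinuousLinearMap.proj (R := ℝ) (φ := fun _ : Fin 4 => ℝ) c).comp
    ((ContinuousLinearMap.proj (R := ℝ) (φ := fun _ : Fin 4 => Fin 4 → ℝ) b).comp
      ((ContinuousLinearMap.proj (R := ℝ) (φ := fun _ : Fin 4 => Fin 4 → Fin 4 → ℝ) a).comp
        (ContinuousLinearMap.snd ℝ Met Con)))

lemma conCoord_apply (a b c : Fin 4) (y : MetCon) : conCoord a b c y = y.2 a b c := rfl

/-- The momenta of the Einstein–Palatini Lagrangian in closed form. -/
def momentumPal (g : Met) (μ : Fin 4) : MetCon →L[ℝ] ℝ :=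
  ∑ α, ∑ β, densInv g α β • (conCoord μ β α - delta μ β • ∑ γ, conCoord γ γ α)

lemma momentumPal_apply (g : Met) (μ : Fin 4) (y : MetCon) :
    momentumPal g μ y = conPair (densInv g) y.2 μ := by
  simp only [momentumPal, sum_apply, smul_apply, sub_apply, smul_eq_mul, conCoord_apply, conPair,
    conTrace]

/-- The component `p` of the Hamiltonian section. -/
def hamPal (y : MetCon) : ℝ := ∑ α, ∑ β, densInv y.1 α β * ricciQuad y.2 y.2 α β

/-- Affine in the velocities, so the momenta are the coefficients of the linear part and `p` is the
velocity-free remainder. -/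
lemma lagEP_eq (x : Base) (y : MetCon) (u : Fin 4 → MetCon) :
    lagEP (x, y, u) = ∑ μ, momentumPal y.1 μ (u μ) + hamPal y := by
  have h : ∑ μ, momentumPal y.1 μ (u μ) = ∑ α, ∑ β, densInv y.1 α β *
      ∑ γ, ((u γ).2 γ β α - (u β).2 γ γ α) := by
    simp only [momentumPal_apply, conPair]
    rw [Finset.sum_comm]
    refine Finset.sum_congr rfl fun α _ => ?_
    rw [Finset.sum_comm]
    refine Finset.sum_congr rfl fun β _ => ?_
    rw [← Finset.mul_sum, Finset.sum_sub_distrib, Finset.sum_sub_distrib,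
      sum_delta_mul' β (fun μ => conTrace (u μ).2 α)]
    rfl
  rw [h, lagEP, hamPal]
  simp only [ricci_eq, densInv, ← Finset.sum_add_distrib]
  rw [Finset.mul_sum]
  refine Finset.sum_congr rfl fun α _ => ?_
  rw [Finset.mul_sum]
  exact Finset.sum_congr rfl fun β _ => by ring

lemma momentum_lagEP (j : Jet MetCon) : momentum lagEP j = momentumPal j.2.1.1 := by
  obtain ⟨x, y, u⟩ := j
  have h1 : HasFDerivAt (fun u : Fin 4 → MetCon => lagEP (x, y, u))
      (∑ μ, (momentumPal y.1 μ).comp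
        (ContinuousLinearMap.proj (R := ℝ) (φ := fun _ : Fin 4 => MetCon) μ)) u := by
    simp only [lagEP_eq]
    refine HasFDerivAt.add_const _ (HasFDerivAt.fun_sum fun μ _ => ?_)
    exact ((momentumPal y.1 μ).comp
      (ContinuousLinearMap.proj (R := ℝ) (φ := fun _ : Fin 4 => MetCon) μ)).hasFDerivAt
  ext μ : 1
  refine ContinuousLinearMap.ext fun k => ?_
  change fderiv ℝ (fun u : Fin 4 → MetCon => lagEP (x, y, u)) u
    (Pi.single (M := fun _ : Fin 4 => MetCon) μ k) = _
  rw [h1.fderiv]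
  simp only [sum_apply, ContinuousLinearMap.comp_apply, ContinuousLinearMap.proj_apply]
  rw [Finset.sum_eq_single μ]
  · rw [Pi.single_eq_same]
  · intro ν _ hν
    rw [Pi.single_eq_of_ne hν, map_zero]
  · simp

/-- The Hamiltonian section as a section over the configuration bundle. -/
def sectionPal (c : Conf MetCon) : EMom MetCon := ((c.1, c.2, momentumPal c.2.1), hamPal c.2)

lemma extLegendre_lagEP (j : Jet MetCon) : extLegendre lagEP j = sectionPal (j.1, j.2.1) := by
  have h1 : legendre lagEP j = (sectionPal (j.1, j.2.1)).1 := by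
    rw [legendre, momentum_lagEP]
    rfl
  refine Prod.ext h1 ?_
  change lagEP j - ∑ μ, momentum lagEP j μ (j.2.2 μ) = hamPal j.2.1
  rw [momentum_lagEP, show j = (j.1, j.2.1, j.2.2) from rfl, lagEP_eq]
  simp

/-- The extended Legendre map forgets velocities, so whatever preimages `invFunOn` selects, the
result is the same; zero velocity witnesses that one exists. -/
lemma hamSection_nonMomenta {U : Set Base} {c : Conf MetCon} (hc : c ∈ confEP U) :
    (hamSection U ∘ nonMomenta U) c = sectionPal c := by
  have h1 : ∃ q ∈ imageP U, tau q = c :=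
    ⟨_, ⟨(c.1, c.2, 0), hc, rfl⟩, rfl⟩
  obtain ⟨⟨j, hj, hjq⟩, hq⟩ := invFunOn_pos h1
  have h2 : nonMomenta U c = (sectionPal c).1 := by
    change invFunOn tau (imageP U) c = _
    rw [← hjq] at hq ⊢
    have hq' : (j.1, j.2.1) = c := hq
    rw [← hq']
    exact congrArg Prod.fst (extLegendre_lagEP j)
  have h3 : ∃ m ∈ imagePtilde U, m.1 = nonMomenta U c :=
    ⟨_, ⟨(c.1, c.2, 0), hc, rfl⟩, by rw [h2, extLegendre_lagEP]⟩
  obtain ⟨⟨j', hj', hm⟩, hm'⟩ := invFunOn_pos h3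
  change invFunOn Prod.fst (imagePtilde U) (nonMomenta U c) = _
  rw [← hm] at hm' ⊢
  rw [extLegendre_lagEP] at hm' ⊢
  rw [h2] at hm'
  have e1 : j'.1 = c.1 := congrArg Prod.fst hm'
  have e2 : j'.2.1 = c.2 := congrArg (fun q => q.2.1) hm'
  rw [e1, e2]

lemma contDiffAt_momentumPal {n : ℕ∞} {g : Met} (hg : (gMat g).det ≠ 0) :
    ContDiffAt ℝ n momentumPal g :=
  contDiffAt_pi.2 fun _ => ContDiffAt.sum fun α _ => ContDiffAt.sum fun β _ =>
    (contDiffAt_densInv hg α β).smul contDiffAt_const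

lemma contDiff_con_apply {n : ℕ∞} (a b c : Fin 4) : ContDiff ℝ n fun y : MetCon => y.2 a b c :=
  (conCoord a b c).contDiff

lemma contDiffAt_hamPal {n : ℕ∞} {y : MetCon} (hg : (gMat y.1).det ≠ 0) :
    ContDiffAt ℝ n hamPal y := by
  have h := fun a b c => (contDiff_con_apply (n := n) a b c).contDiffAt (x := y)
  refine ContDiffAt.sum fun α _ => ContDiffAt.sum fun β _ => ContDiffAt.mul ?_ ?_
  · exact (contDiffAt_densInv hg α β).comp y contDiffAt_fst
  · exact ContDiffAt.sum fun γ _ => ContDiffAt.sum fun σ _ =>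
      ((h _ _ _).mul (h _ _ _)).sub ((h _ _ _).mul (h _ _ _))

lemma contDiffAt_sectionPal {n : ℕ∞} {c : Conf MetCon} (hg : (gMat c.2.1).det ≠ 0) :
    ContDiffAt ℝ n sectionPal c := by
  refine ContDiffAt.prodMk (contDiffAt_fst.prodMk (contDiffAt_snd.prodMk ?_)) ?_
  · exact (contDiffAt_momentumPal (g := c.2.1) hg).comp c (contDiffAt_fst.comp c contDiffAt_snd)
  · exact (contDiffAt_hamPal (y := c.2) hg).comp c contDiffAt_snd

/-! ### The boundary term -/

/-- The vector density `ϱ g^{αβ} (Γ^μ_{βα} - δ^μ_β Γ^γ_{γα})`. -/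
def boundaryPal (y : MetCon) (μ : Fin 4) : ℝ := conPair (densInv y.1) y.2 μ

lemma contDiffAt_boundaryPal {n : ℕ∞} {y : MetCon} (hg : (gMat y.1).det ≠ 0) (μ : Fin 4) :
    ContDiffAt ℝ n (fun y => boundaryPal y μ) y := by
  unfold boundaryPal conPair conTrace
  have h := fun a b c => (contDiff_con_apply (n := n) a b c).contDiffAt (x := y)
  refine ContDiffAt.sum fun α _ => ContDiffAt.sum fun β _ => ContDiffAt.mul ?_ ?_
  · exact (contDiffAt_densInv hg α β).comp y contDiffAt_fst
  · exact (h _ _ _).sub (contDiffAt_const.mul (ContDiffAt.sum fun γ _ => h _ _ _))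

lemma fderiv_boundaryPal {y : MetCon} (hg : (gMat y.1).det ≠ 0) (μ : Fin 4) (k : MetCon) :
    fderiv ℝ (fun y => boundaryPal y μ) y k =
      conPair (fun α β => fderiv ℝ (fun g => densInv g α β) y.1 k.1) y.2 μ +
        conPair (densInv y.1) k.2 μ := by
  have hS : ∀ α β, HasFDerivAt (fun y : MetCon => densInv y.1 α β)
      ((fderiv ℝ (fun g => densInv g α β) y.1).comp (ContinuousLinearMap.fst ℝ Met Con)) y :=
    fun α β => (((contDiffAt_densInv (n := 1) hg α β).differentiableAt
      (by simp)).hasFDerivAt (x := y.1)).comp y hasFDerivAt_fst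
  have hC : ∀ a b c, HasFDerivAt (fun y : MetCon => y.2 a b c) (conCoord a b c) y :=
    fun a b c => (conCoord a b c).hasFDerivAt
  have h1 : HasFDerivAt (fun y => boundaryPal y μ) _ y :=
    HasFDerivAt.fun_sum (u := Finset.univ) fun α _ =>
      HasFDerivAt.fun_sum (u := Finset.univ) fun β _ =>
        (hS α β).mul ((hC μ β α).sub
          ((HasFDerivAt.fun_sum (u := Finset.univ) fun γ _ => hC γ γ α).const_mul (delta μ β)))
  rw [h1.fderiv]
  simp only [sum_apply, add_apply, smul_apply, sub_apply, smul_eq_mul, conCoord_apply,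
    ContinuousLinearMap.comp_apply, ContinuousLinearMap.coe_fst', Pi.sub_apply, conPair,
    conTrace,
    ← Finset.sum_add_distrib]
  exact Finset.sum_congr rfl fun α _ => Finset.sum_congr rfl fun β _ => by ring

/-- On the torsion constraints the connection is projectively equivalent to the Levi-Civita
connection with metric derivatives `ḡ_{αβ,μ}`. -/
lemma christoffel_gBar {c : Conf MetCon} (hc : c ∈ torsionSpace) (hg : (gMat c.2.1).det ≠ 0)
    (a b d : Fin 4) :
    c.2.2 a b d = christoffel c.2.1 (gBar c.2.1 c.2.2) a b d +
      delta a d * (-(1 / 3) * ∑ ν, torsion c.2.2 ν ν b) := by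
  obtain ⟨x, g, Γ⟩ := c
  simp only at hg ⊢
  set A : Fin 4 → ℝ := fun b => (1 / 3) * ∑ ν, torsion Γ ν ν b with hA
  have ht : ∀ a b d, Γ a b d - Γ a d b = delta a b * A d - delta a d * A b := by
    intro a b d
    have : torsion Γ a b d = _ := hc a b d
    rw [torsion] at this
    rw [this, hA]
    ring
  -- The constraints make the torsion `δ^a_b A_d - δ^a_d A_b`, which this shift removes. Lowering
  -- the index and symmetrising adds `2 g_{αβ} A_μ`, the `2/3` trace term of `gBar`, so `Γ'` is
  -- torsion-free and metric.
  set Γ' : Con := fun a b d => Γ a b d + delta a d * A b with hΓ'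
  have h1 : christoffel g (gBar g Γ) = Γ' := by
    refine christoffel_unique hg ?_ ?_
    · intro a b d
      simp only [hΓ']
      linear_combination ht a b d
    · intro μ α β
      have e : gBar g Γ μ s(α, β) =
        ∑ l, (g s(α, l) * Γ l μ β + g s(β, l) * Γ l μ α) +
          (2 / 3) * g s(α, β) * ∑ l, torsion Γ l l μ := rfl
      have e1 : ∀ α β, ∑ l, g s(α, l) * Γ' l μ β = ∑ l, g s(α, l) * Γ l μ β + g s(α, β) * A μ := by
        intro α β
        rw [← sum_mul_delta' β fun l => g s(α, l)]
        simp only [hΓ', Finset.sum_mul, ← Finset.sum_add_distrib]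
        exact Finset.sum_congr rfl fun l _ => by ring
      rw [e, e1, e1, Finset.sum_add_distrib, Sym2.eq_swap (a := β) (b := α)]
      simp only [hA]
      ring
  rw [h1]
  simp only [hΓ', hA]
  ring

lemma hamPal_eq_quadLag {c : Conf MetCon} (hc : c ∈ torsionSpace) (hg : (gMat c.2.1).det ≠ 0) :
    hamPal c.2 = quadLag c.2.1 (gBar c.2.1 c.2.2) (gBar c.2.1 c.2.2) := by
  simp only [hamPal, quadLag,
    ricciQuad_projective (christoffel c.2.1 (gBar c.2.1 c.2.2)) c.2.2 _ (christoffel_gBar hc hg)]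

/-- The Leibniz rule `S dΓ = -Γ dS + d(SΓ)` with `S = ϱ g^{αβ}`. In the middle term projective
invariance replaces `Γ` by the Levi-Civita connection of `ḡ`. -/
lemma momentumPal_eq {c : Conf MetCon} (hc : c ∈ torsionSpace) (hg : (gMat c.2.1).det ≠ 0)
    (μ : Fin 4) :
    momentumPal c.2.1 μ =
      (momentumBar c.2.1 (gBar c.2.1 c.2.2) μ).comp (ContinuousLinearMap.fst ℝ Met Con) +
        fderiv ℝ (fun y => boundaryPal y μ) c.2 := by
  refine ContinuousLinearMap.ext fun k => ?_
  have h1 := momentum_lagBar (x := c.1) hg (gBar c.2.1 c.2.2) μ k.1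
  rw [momentum_lagBar_eq hg, ← conPair_projective _ (fun α β => fderiv_densInv_comm _ _ α β) _ _ _
    (christoffel_gBar hc hg)] at h1
  rw [add_apply, ContinuousLinearMap.comp_apply, ContinuousLinearMap.coe_fst', h1,
    momentumPal_apply, fderiv_boundaryPal hg]
  ring

/-! ### Lorentz metrics form an open set -/

lemma IsLorentz.det_ne_zero {g : Met} (h : IsLorentz g) : (gMat g).det ≠ 0 := by
  obtain ⟨A, _, e⟩ := h
  intro h0
  have := congrArg Matrix.det e
  rw [Matrix.det_mul, Matrix.det_mul, h0, Matrix.det_diagonal] at this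
  simp [Fin.prod_univ_four] at this

/-- The signs of the Minkowski metric. -/
def minkSign : Fin 4 → ℝ := ![-1, 1, 1, 1]

lemma minkSign_mul_self (k : Fin 4) : minkSign k * minkSign k = 1 := by
  fin_cases k <;> simp [minkSign]

/-- The metric `Bᵀ η B`. -/
def frameMet (B : Fin 4 → Fin 4 → ℝ) : Met := fun p =>
  Sym2.lift ⟨fun α β => ∑ k, minkSign k * (B k α * B k β),
    fun α β => Finset.sum_congr rfl fun k _ => by rw [mul_comm (B k α)]⟩ p

lemma frameMet_apply (B : Fin 4 → Fin 4 → ℝ) (α β : Fin 4) :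
    frameMet B s(α, β) = ∑ k, minkSign k * (B k α * B k β) := rfl

lemma gMat_frameMet (B : Fin 4 → Fin 4 → ℝ) :
    gMat (frameMet B) = (Matrix.of B).transpose * Matrix.diagonal minkSign * Matrix.of B := by
  ext α β
  rw [gMat_apply, frameMet_apply, Matrix.mul_apply]
  refine Finset.sum_congr rfl fun k _ => ?_
  rw [Matrix.mul_diagonal, Matrix.transpose_apply, Matrix.of_apply, Matrix.of_apply]
  ring

lemma contDiff_frameMet {n : ℕ∞} : ContDiff ℝ n frameMet := by
  refine contDiff_pi.2 fun p => ?_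
  induction p using Sym2.ind with
  | _ α β =>
    simp only [frameMet_apply]
    fun_prop

/-- At the identity the derivative of `B ↦ Bᵀ η B` is `H ↦ ηH + (ηH)ᵀ`. It is onto the symmetric
forms, since `η² = 1` makes `H = ½ η S` a preimage of `S`, so the map is locally open there. -/
lemma map_nhds_frameMet : map frameMet (𝓝 fun α β => delta α β) =
    𝓝 (frameMet fun α β => delta α β) := by
  have h1 := (contDiff_frameMet (n := 1)).contDiffAt (x := fun α β => delta α β)
  refine (h1.hasStrictFDerivAt (by simp)).map_nhds_eq_of_surj
    (LinearMap.range_eq_top.2 fun S => ?_)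
  refine ⟨fun α β => 1 / 2 * minkSign α * S s(α, β), ?_⟩
  set H : Fin 4 → Fin 4 → ℝ := fun α β => 1 / 2 * minkSign α * S s(α, β) with hH
  have h2 := ((h1.differentiableAt (by simp)).hasFDerivAt).hasLineDerivAt H
  have h3 : ∀ t : ℝ, frameMet ((fun α β => delta α β) + t • H) =
      frameMet (fun α β => delta α β) + t • S + t ^ 2 • frameMet H := by
    intro t
    ext p
    induction p using Sym2.ind with
    | _ α β =>
      have e1 : ∀ k, minkSign k * ((delta k α + t * H k α) * (delta k β + t * H k β)) =
          minkSign k * (delta k α * delta k β) + t * (delta k α * (minkSign k * H k β))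
          + t * (delta k β * (minkSign k * H k α)) + t ^ 2 * (minkSign k * (H k α * H k β)) :=
        fun k => by ring
      have e2 : ∀ α β, minkSign α * H α β = 1 / 2 * S s(α, β) := fun α β => by
        rw [hH]
        linear_combination 1 / 2 * S s(α, β) * minkSign_mul_self α
      simp only [Pi.add_apply, Pi.smul_apply, smul_eq_mul, frameMet_apply, e1, e2,
        Finset.sum_add_distrib, ← Finset.mul_sum, sum_delta_mul']
      rw [Sym2.eq_swap (a := β)]
      ring
  have h4 : HasLineDerivAt ℝ frameMet S (fun α β => delta α β) H := by
    unfold HasLineDerivAt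
    simp only [h3]
    have d1 : HasDerivAt (fun t : ℝ => t • S) _ 0 := (hasDerivAt_id (0 : ℝ)).smul_const S
    have d2 : HasDerivAt (fun t : ℝ => t ^ 2 • frameMet H) _ 0 :=
      (hasDerivAt_pow 2 (0 : ℝ)).smul_const _
    exact ((d1.const_add _).add d2).congr_deriv (by simp)
  exact h2.unique h4

/-- A frame `A` carries `g` to the Minkowski metric by the continuous map `T`, and every form near
the latter is `Bᵀ η B` with `B` invertible. -/
lemma isOpen_isLorentz : IsOpen {g : Met | IsLorentz g} := by
  rw [isOpen_iff_mem_nhds]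
  rintro g ⟨A, hA, e⟩
  set T : Met → Met := fun g p => Sym2.lift ⟨fun α β => ∑ k, ∑ l, A k α * g s(k, l) * A l β,
    fun α β => by
      dsimp only
      rw [Finset.sum_comm]
      refine Finset.sum_congr rfl fun k _ => Finset.sum_congr rfl fun l _ => ?_
      rw [Sym2.eq_swap (a := l)]
      ring⟩ p with hT
  have hTm : ∀ g, gMat (T g) = A.transpose * gMat g * A := by
    intro g
    ext α β
    change ∑ k, ∑ l, A k α * g s(k, l) * A l β = _
    simp only [Matrix.mul_apply, Finset.sum_mul]
    rw [Finset.sum_comm]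
    rfl
  have hTc : Continuous T := by
    refine continuous_pi fun p => ?_
    induction p using Sym2.ind with
    | _ α β =>
      change Continuous fun g : Met => ∑ k, ∑ l, A k α * g s(k, l) * A l β
      fun_prop
  have hinj : ∀ g g' : Met, gMat g = gMat g' → g = g' := by
    intro g g' h
    ext p
    induction p using Sym2.ind with
    | _ α β => exact congrFun (congrFun h α) β
  have hone : Matrix.of (fun α β => delta α β) = (1 : Matrix (Fin 4) (Fin 4) ℝ) := by
    ext α β
    exact (one_apply_eq_delta α β).symm
  have hTg : T g = frameMet fun α β => delta α β := by
    apply hinj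
    rw [hTm, e, gMat_frameMet, hone, Matrix.transpose_one, Matrix.one_mul, Matrix.mul_one]
    rfl
  have hdet : ∀ᶠ B : Fin 4 → Fin 4 → ℝ in 𝓝 (fun α β => delta α β), (Matrix.of B).det ≠ 0 := by
    refine ContinuousAt.eventually_ne (g := fun B : Fin 4 → Fin 4 → ℝ => (Matrix.of B).det)
      (Continuous.matrix_det (A := fun B : Fin 4 → Fin 4 → ℝ => Matrix.of B)
        continuous_id).continuousAt ?_
    simp only [hone, Matrix.det_one, ne_eq, one_ne_zero, not_false_eq_true]
  have hmem : frameMet '' {B | (Matrix.of B).det ≠ 0} ∈ 𝓝 (T g) := by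
    rw [hTg, ← map_nhds_frameMet]
    exact image_mem_map hdet
  filter_upwards [hTc.continuousAt hmem] with g' hg'
  obtain ⟨B, hB, hBg⟩ := hg'
  set M : Matrix (Fin 4) (Fin 4) ℝ := Matrix.of B
  have hM : IsUnit M.det := Ne.isUnit hB
  -- From `Aᵀ g' A = Mᵀ η M`, the corrected frame `A M⁻¹` brings `g'` to `η`.
  refine ⟨A * M⁻¹, ?_, ?_⟩
  · rw [Matrix.det_mul]
    exact hA.mul (Matrix.isUnit_nonsing_inv_det _ hM)
  · have h1 : A.transpose * gMat g' * A = M.transpose * Matrix.diagonal minkSign * M := by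
      rw [← hTm, ← hBg]
      exact gMat_frameMet M
    calc (A * M⁻¹).transpose * gMat g' * (A * M⁻¹)
        = M⁻¹.transpose * (A.transpose * gMat g' * A) * M⁻¹ := by
          simp only [Matrix.transpose_mul, Matrix.mul_assoc]
      _ = (M * M⁻¹).transpose * Matrix.diagonal minkSign * (M * M⁻¹) := by
          rw [h1]
          simp only [Matrix.transpose_mul, Matrix.mul_assoc]
      _ = Matrix.diagonal ![-1, 1, 1, 1] := by
          rw [Matrix.mul_nonsing_inv _ hM, Matrix.transpose_one, Matrix.one_mul, Matrix.mul_one]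
          rfl

lemma isOpen_confEP {U : Set Base} (hU : IsOpen U) : IsOpen (confEP U) :=
  (hU.preimage continuous_fst).inter
    (isOpen_isLorentz.preimage (continuous_fst.comp continuous_snd))

lemma isOpen_jetEH {U : Set Base} (hU : IsOpen U) : IsOpen (jetEH U) :=
  (hU.preimage continuous_fst).inter
    (isOpen_isLorentz.preimage (continuous_fst.comp continuous_snd))

/-! ### The inverse of the Legendre map of `L̄` -/

lemma momentumBar_add_smul (g : Met) (u u' : Fin 4 → Met) (t : ℝ) :
    momentumBar g (u + t • u') = momentumBar g u + t • momentumBar g u' := by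
  ext μ h
  simp only [momentumBar, Pi.add_apply, Pi.smul_apply, add_apply, smul_apply, neg_apply,
    sum_apply, smul_eq_mul, christoffel_add_smul,
    conTrace_add_smul (christoffel_add_smul g u u' t), mul_neg, Finset.mul_sum, ← neg_add,
    ← Finset.sum_add_distrib]
  congr 1
  exact Finset.sum_congr rfl fun α _ => Finset.sum_congr rfl fun β _ => by ring

lemma legendre_lagBar {j : Jet Met} (hj : (gMat j.2.1).det ≠ 0) :
    legendre lagBar j = (j.1, j.2.1, momentumBar j.2.1 j.2.2) :=
  congrArg Prod.fst (extLegendre_lagBar hj)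

/-- The momenta are linear in the velocities, so injectivity reduces to the trivial kernel of
`eq_zero_of_momentumBar`. -/
lemma injOn_legendre_lagBar (U : Set Base) : Set.InjOn (legendre lagBar) (jetEH U) := by
  rintro ⟨x, g, v⟩ hj ⟨x', g', v'⟩ hj' e
  rw [legendre_lagBar hj.2.det_ne_zero, legendre_lagBar hj'.2.det_ne_zero] at e
  simp only [Prod.mk.injEq] at e
  obtain ⟨rfl, rfl, e⟩ := e
  have h : momentumBar g (v + (-1 : ℝ) • v') = 0 := by
    rw [momentumBar_add_smul, e]
    exact (congrArg (momentumBar g v' + ·) (neg_one_smul ℝ (momentumBar g v'))).trans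
      (add_neg_cancel _)
  have := eq_zero_of_momentumBar hj.2.det_ne_zero h
  rw [neg_one_smul, ← sub_eq_add_neg, sub_eq_zero] at this
  rw [this]

lemma contDiffAt_legendre_lagBar {n : ℕ∞} {j : Jet Met} (hj : (gMat j.2.1).det ≠ 0) :
    ContDiffAt ℝ n (legendre lagBar) j :=
  contDiffAt_fst.comp j (contDiffAt_extLegendre_lagBar hj)

/-- The map preserves `(x, g)`, so a kernel vector is vertical. Along a vertical line the map is
affine with slope `momentumBar g u`, which vanishes only for `u = 0`. -/
lemma injective_fderiv_legendre_lagBar {j : Jet Met} (hj : (gMat j.2.1).det ≠ 0) :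
    Injective (fderiv ℝ (legendre lagBar) j) := by
  have hd : HasFDerivAt (legendre lagBar) (fderiv ℝ (legendre lagBar) j) j :=
    ((contDiffAt_legendre_lagBar (n := 1) hj).differentiableAt (by simp)).hasFDerivAt
  rw [injective_iff_map_eq_zero]
  rintro ⟨a, h, u⟩ h0
  obtain ⟨x, g, v⟩ := j
  have h1 : HasFDerivAt (fun j : Jet Met => (j.1, j.2.1)) _ (x, g, v) :=
    hd.fst.prodMk hd.snd.fst
  have h2 : HasFDerivAt (fun j : Jet Met => (j.1, j.2.1)) _ (x, g, v) :=
    ((ContinuousLinearMap.fst ℝ Base (Met × (Fin 4 → Met))).prod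
      ((ContinuousLinearMap.fst ℝ Met (Fin 4 → Met)).comp
        (ContinuousLinearMap.snd ℝ Base (Met × (Fin 4 → Met))))).hasFDerivAt
  have h3 := congrArg (fun l : Jet Met →L[ℝ] Base × Met => l (a, h, u)) (h2.unique h1)
  have h4 : (a, h) = (0 : Base × Met) := by
    refine h3.trans ?_
    change ((fderiv ℝ (legendre lagBar) (x, g, v) (a, h, u)).1,
      (fderiv ℝ (legendre lagBar) (x, g, v) (a, h, u)).2.1) = 0
    rw [h0]
    rfl
  obtain ⟨rfl, rfl⟩ := Prod.mk.inj h4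
  have h5 := hd.hasLineDerivAt (0, 0, u)
  have h6 : HasLineDerivAt ℝ (legendre lagBar)
      ((0, 0, momentumBar g u) : RMom Met) (x, g, v) (0, 0, u) := by
    have e : ∀ t : ℝ, legendre lagBar ((x, g, v) + t • (0, 0, u)) =
        (x, g, momentumBar g v) + t • ((0, 0, momentumBar g u) : RMom Met) := by
      intro t
      have e1 : ((x, g, v) : Jet Met) + t • (0, 0, u) = (x, g, v + t • u) := by simp
      rw [e1, legendre_lagBar (j := (x, g, v + t • u)) hj, momentumBar_add_smul]
      simp
    unfold HasLineDerivAt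
    simp only [e]
    exact (((hasDerivAt_id (0 : ℝ)).smul_const _).const_add _).congr_deriv (by simp)
  have h7 := h6.unique h5
  rw [h0] at h7
  have h8 : momentumBar g u = 0 := congrArg (fun q : RMom Met => q.2.2) h7
  rw [eq_zero_of_momentumBar hj h8]
  rfl

lemma finrank_jet_eq : Module.finrank ℝ (Jet Met) = Module.finrank ℝ (RMom Met) := by
  have h : Module.finrank ℝ (Met →L[ℝ] ℝ) = Module.finrank ℝ Met := by
    rw [← (LinearMap.toContinuousLinearMap (𝕜 := ℝ) (E := Met) (F' := ℝ)).finrank_eq]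
    exact Subspace.dual_finrank_eq
  rw [Module.finrank_prod, Module.finrank_prod, Module.finrank_prod, Module.finrank_prod,
    Module.finrank_pi_fintype ℝ (M := fun _ : Fin 4 => Met),
    Module.finrank_pi_fintype ℝ (M := fun _ : Fin 4 => Met →L[ℝ] ℝ), h]

/-- By global injectivity `invFunOn` is a left inverse on the open set `jetEH U`, so near the image
point it coincides with the differentiable local inverse. -/
lemma differentiableAt_invFunOn_legendre {U : Set Base} (hU : IsOpen U) {j : Jet Met}
    (hj : j ∈ jetEH U) :
    DifferentiableAt ℝ (invFunOn (legendre lagBar) (jetEH U)) (legendre lagBar j) := by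
  have hdet := hj.2.det_ne_zero
  set l := (fderiv ℝ (legendre lagBar) j)
  set E := (LinearMap.linearEquivOfInjective (l : Jet Met →ₗ[ℝ] RMom Met)
    (injective_fderiv_legendre_lagBar hdet) finrank_jet_eq).toContinuousLinearEquiv
  have hE : (E : Jet Met →L[ℝ] RMom Met) = l := by
    refine ContinuousLinearMap.ext fun x => ?_
    rfl
  have hs : HasStrictFDerivAt (legendre lagBar) (E : Jet Met →L[ℝ] RMom Met) j := by
    rw [hE]
    exact (contDiffAt_legendre_lagBar (n := 1) hdet).hasStrictFDerivAt (by simp)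
  have h1 : ∀ᶠ x in 𝓝 j, invFunOn (legendre lagBar) (jetEH U) (legendre lagBar x) = x := by
    filter_upwards [(isOpen_jetEH hU).mem_nhds hj] with x hx
    exact (injOn_legendre_lagBar U).leftInvOn_invFunOn hx
  exact hs.to_localInverse.hasFDerivAt.differentiableAt.congr_of_eventuallyEq
    (hs.localInverse_unique h1)

lemma pullback_omegaHbar {V : Type*} [NormedAddCommGroup V] [NormedSpace ℝ V] {U : Set Base}
    (hU : IsOpen U) {f : V → Jet Met} {w : V} (hf : DifferentiableAt ℝ f w) (hw : f w ∈ jetEH U) :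
    pullback (legendre lagBar ∘ f) (omegaHbar U) w = pullback f omegaLbar w := by
  have hL : DifferentiableAt ℝ (legendre lagBar) (f w) :=
    (contDiffAt_legendre_lagBar (n := 1) hw.2.det_ne_zero).differentiableAt (by simp)
  have hi := differentiableAt_invFunOn_legendre hU hw
  unfold omegaHbar
  rw [← pullback_comp (f := legendre lagBar ∘ f) omegaLbar hi (hL.comp w hf)]
  refine pullback_congr _ ?_
  filter_upwards [hf.continuousAt.eventually ((isOpen_jetEH hU).mem_nhds hw)] with x hx
  exact (injOn_legendre_lagBar U).leftInvOn_invFunOn hx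

/-! ### Comparison of the Liouville and Poincaré–Cartan forms -/

lemma differentiableAt_pullback {V W : Type*} [NormedAddCommGroup V] [NormedSpace ℝ V]
    [NormedAddCommGroup W] [NormedSpace ℝ W] {k : ℕ} {f : V → W} {v : V}
    {ω : W → W [⋀^Fin k]→L[ℝ] ℝ} (hω : DifferentiableAt ℝ ω (f v)) (hf : ContDiffAt ℝ 2 f v) :
    DifferentiableAt ℝ (pullback f ω) v :=
  DifferentiableAt.continuousAlternatingMapCompContinuousLinearMap
    (hω.comp v (hf.differentiableAt (by simp)))
    ((hf.fderiv_right (m := 1) (by norm_num)).differentiableAt (by simp))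

lemma contDiffAt_gBar {n : ℕ∞} (y : MetCon) :
    ContDiffAt ℝ n (fun y : MetCon => gBar y.1 y.2) y := by
  have h := fun a b c => (contDiff_con_apply (n := n) a b c).contDiffAt (x := y)
  have hg : ∀ p, ContDiffAt ℝ n (fun y : MetCon => y.1 p) y := fun p =>
    ((ContinuousLinearMap.proj (R := ℝ) (φ := fun _ : Sym2 (Fin 4) => ℝ) p).comp
      (ContinuousLinearMap.fst ℝ Met Con)).contDiff.contDiffAt
  refine contDiffAt_pi.2 fun μ => contDiffAt_pi.2 fun p => ?_
  induction p using Sym2.ind with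
  | _ α β =>
    exact (ContDiffAt.sum fun l _ => ((hg _).mul (h _ _ _)).add ((hg _).mul (h _ _ _))).add
      ((contDiffAt_const.mul (hg _)).mul (ContDiffAt.sum fun l _ => (h _ _ _).sub (h _ _ _)))

lemma contDiffAt_xi {n : ℕ∞} (c : Conf MetCon) : ContDiffAt ℝ n xi c :=
  contDiffAt_fst.prodMk ((contDiffAt_fst.comp c contDiffAt_snd).prodMk
    ((contDiffAt_gBar c.2).comp c contDiffAt_snd))

lemma contDiffAt_embPf {n : ℕ∞} (w : torsionSpace) : ContDiffAt ℝ n embPf w :=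
  torsionSpace.subtypeL.contDiff.contDiffAt

/-- The map `(x^0, …, W^μ, …, x^3)`. -/
def boundaryMap (μ : Fin 4) (c : Conf MetCon) : Fin 4 → ℝ := update c.1 μ (boundaryPal c.2 μ)

lemma contDiffAt_boundaryMap {n : ℕ∞} {c : Conf MetCon} (hg : (gMat c.2.1).det ≠ 0)
    (μ : Fin 4) : ContDiffAt ℝ n (boundaryMap μ) c := by
  refine contDiffAt_pi.2 fun ν => ?_
  by_cases h : ν = μ
  · subst h
    simp only [boundaryMap, update_self]
    exact (contDiffAt_boundaryPal (n := n) (y := c.2) hg ν).comp c contDiffAt_snd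
  · simp only [boundaryMap, update_of_ne h]
    exact (dx (F := MetCon) ν).contDiff.contDiffAt

/-- Exhibits `dW^μ ∧ d³x_μ` as the pullback of a constant 4-form, from which its closedness is read
off. -/
lemma pullback_boundaryMap {w : torsionSpace} (hg : (gMat (embPf w).2.1).det ≠ 0) (μ : Fin 4) :
    pullback (boundaryMap μ ∘ embPf) (fun _ => detForm) w =
      wedge (update (fun ν => (dx ν).comp torsionSpace.subtypeL) μ
        ((dy (fderiv ℝ (fun y => boundaryPal y μ) (embPf w).2)).comp torsionSpace.subtypeL)) := by
  have h1 : DifferentiableAt ℝ (boundaryMap μ ∘ embPf) w :=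
    ((contDiffAt_boundaryMap (n := 1) hg μ).comp w (contDiffAt_embPf w)).differentiableAt (by simp)
  rw [pullback_detForm h1]
  congr 1
  ext1 ν
  by_cases h : ν = μ
  · subst h
    rw [update_self]
    have h2 : HasFDerivAt (fun y => boundaryPal y ν) _ (embPf w).2 :=
      ((contDiffAt_boundaryPal (n := 1) hg ν).differentiableAt (by simp)).hasFDerivAt
    have h3 : HasFDerivAt (fun w : torsionSpace => (embPf w).2)
        ((ContinuousLinearMap.snd ℝ Base MetCon).comp torsionSpace.subtypeL) w :=
      ((ContinuousLinearMap.snd ℝ Base MetCon).comp torsionSpace.subtypeL).hasFDerivAt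
    have h4 : (fun x => (boundaryMap ν ∘ embPf) x ν) =
        fun w : torsionSpace => boundaryPal (embPf w).2 ν := by
      ext w
      simp [boundaryMap]
    rw [h4]
    exact (h2.comp w h3).fderiv
  · rw [update_of_ne h]
    have h4 : (fun x => (boundaryMap μ ∘ embPf) x ν) =
        ((dx (F := MetCon) ν).comp torsionSpace.subtypeL) := by
      ext w
      simp only [boundaryMap, comp_apply, update_of_ne h]
      rfl
    rw [h4, ContinuousLinearMap.fderiv]

lemma pullback_theta {w : torsionSpace} (hg : (gMat (embPf w).2.1).det ≠ 0) :
    pullback (sectionPal ∘ embPf) liouvilleTheta w =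
      pullback (xi ∘ embPf) (poincareCartanTheta lagBar) w +
        ∑ μ, pullback (boundaryMap μ ∘ embPf) (fun _ => detForm) w := by
  have h1 : DifferentiableAt ℝ (sectionPal ∘ embPf) w :=
    ((contDiffAt_sectionPal (n := 1) hg).comp w (contDiffAt_embPf w)).differentiableAt (by simp)
  have h2 : DifferentiableAt ℝ (xi ∘ embPf) w :=
    ((contDiffAt_xi (n := 1) _).comp w (contDiffAt_embPf w)).differentiableAt (by simp)
  have e1 : fderiv ℝ (fun x => (((sectionPal ∘ embPf) x).1.1, ((sectionPal ∘ embPf) x).1.2.1)) w =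
      torsionSpace.subtypeL := torsionSpace.subtypeL.fderiv
  set P : torsionSpace →L[ℝ] Conf Met :=
    ((ContinuousLinearMap.fst ℝ Base MetCon).prod ((ContinuousLinearMap.fst ℝ Met Con).comp
      (ContinuousLinearMap.snd ℝ Base MetCon))).comp torsionSpace.subtypeL with hP
  have e2 : fderiv ℝ (fun x => (((xi ∘ embPf) x).1, ((xi ∘ embPf) x).2.1)) w = P := P.fderiv
  have hx : (fun ν => (dx (F := Met) ν).comp P) =
      fun ν => (dx (F := MetCon) ν).comp torsionSpace.subtypeL := rfl
  have hξ : extLegendre lagBar ((xi ∘ embPf) w) = extLegendreBar ((xi ∘ embPf) w) :=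
    extLegendre_lagBar (j := (xi ∘ embPf) w) hg
  rw [pullback_liouvilleTheta h1, pullback_poincareCartanTheta _ h2, e1, e2, multiForm_comp,
    multiForm_comp, hx, hξ, add_assoc, ← Finset.sum_add_distrib]
  have hp : ((sectionPal ∘ embPf) w).2 = (extLegendreBar ((xi ∘ embPf) w)).2 :=
    hamPal_eq_quadLag w.2 hg
  rw [hp]
  congr 1
  refine Finset.sum_congr rfl fun μ _ => ?_
  rw [pullback_boundaryMap hg, ← wedge_update_add]
  congr 2
  have h3 := momentumPal_eq w.2 hg μ
  change (dy (momentumPal (embPf w).2.1 μ)).comp torsionSpace.subtypeL = _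
  change momentumPal (embPf w).2.1 μ = _ at h3
  rw [h3]
  rfl

lemma extDeriv_pullback_theta {w : torsionSpace} (hg : (gMat (embPf w).2.1).det ≠ 0) :
    extDeriv (pullback (sectionPal ∘ embPf) liouvilleTheta) w =
      extDeriv (pullback (xi ∘ embPf) (poincareCartanTheta lagBar)) w := by
  -- The exterior derivative needs the identity on a whole neighbourhood; it holds wherever `det g ≠
  -- 0`, an open condition.
  have hev : pullback (sectionPal ∘ embPf) liouvilleTheta =ᶠ[𝓝 w] fun w =>
      pullback (xi ∘ embPf) (poincareCartanTheta lagBar) w +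
        ∑ μ, pullback (boundaryMap μ ∘ embPf) (fun _ => detForm) w := by
    have h1 : ContinuousAt (fun w : torsionSpace => (embPf w).2.1) w :=
      (continuous_fst.comp (continuous_snd.comp continuous_subtype_val)).continuousAt
    filter_upwards [h1.eventually (isOpen_det_ne_zero.mem_nhds hg)] with w' hw' using
      pullback_theta hw'
  have hb : ∀ μ, ContDiffAt ℝ 2 (boundaryMap μ ∘ embPf) w := fun μ =>
    (contDiffAt_boundaryMap (n := 2) hg μ).comp w (contDiffAt_embPf w)
  have hd : ∀ μ, DifferentiableAt ℝ (pullback (boundaryMap μ ∘ embPf) fun _ => detForm) w :=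
    fun μ => differentiableAt_pullback (differentiableAt_const _) (hb μ)
  have hΘ : DifferentiableAt ℝ (pullback (xi ∘ embPf) (poincareCartanTheta lagBar)) w :=
    differentiableAt_pullback
      (differentiableAt_poincareCartanTheta
        ((contDiffAt_extLegendre_lagBar (n := 1) (j := (xi ∘ embPf) w) hg).differentiableAt
          (by simp)))
      ((contDiffAt_xi (n := 2) _).comp w (contDiffAt_embPf w))
  rw [hev.extDeriv_eq]
  set D : Fin 4 → torsionSpace → torsionSpace [⋀^Fin 4]→L[ℝ] ℝ :=
    fun μ => pullback (boundaryMap μ ∘ embPf) fun _ => detForm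
  have hz : ∀ μ, extDeriv (D μ) w = 0 := fun μ => extDeriv_wedge_fderiv (hb μ)
  have hsum : (fun w => pullback (xi ∘ embPf) (poincareCartanTheta lagBar) w + ∑ μ, D μ w) =
      pullback (xi ∘ embPf) (poincareCartanTheta lagBar) + (D 0 + D 1 + D 2 + D 3) := by
    funext w
    simp only [Fin.sum_univ_four, Pi.add_apply]
  change extDeriv (fun w => pullback (xi ∘ embPf) (poincareCartanTheta lagBar) w +
    ∑ μ, D μ w) w = _
  rw [hsum, extDeriv_add hΘ ((((hd 0).add (hd 1)).add (hd 2)).add (hd 3)),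
    extDeriv_add (((hd 0).add (hd 1)).add (hd 2)) (hd 3),
    extDeriv_add ((hd 0).add (hd 1)) (hd 2), extDeriv_add (hd 0) (hd 1)]
  rw [hz 0, hz 1, hz 2, hz 3, add_zero, add_zero, add_zero, add_zero]

lemma pullback_omegaH {U : Set Base} (hU : IsOpen U) {w : torsionSpace} (hw : w ∈ finalP U) :
    pullback embPf (omegaH U) w =
      -extDeriv (pullback (sectionPal ∘ embPf) liouvilleTheta) w := by
  have hg : (gMat (embPf w).2.1).det ≠ 0 := IsLorentz.det_ne_zero hw.2
  have h1 : omegaH U (embPf w) = pullback sectionPal liouvilleOmega (embPf w) := by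
    -- The Hamiltonian section equals `sectionPal` only over `confEP U`, whose openness makes the
    -- germs agree.
    refine pullback_congr _ ?_
    filter_upwards [(isOpen_confEP hU).mem_nhds hw] with c hc using hamSection_nonMomenta hc
  have h2 : pullback embPf (omegaH U) w =
      pullback embPf (pullback sectionPal liouvilleOmega) w := by
    change (omegaH U (embPf w)).compContinuousLinearMap _ = _
    rw [h1]
    rfl
  have hs : ContDiffAt ℝ 2 (sectionPal ∘ embPf) w :=
    (contDiffAt_sectionPal (n := 2) hg).comp w (contDiffAt_embPf w)
  rw [h2, ← pullback_comp _ ((contDiffAt_sectionPal (n := 1) hg).differentiableAt (by simp))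
    ((contDiffAt_embPf (n := 1) w).differentiableAt (by simp))]
  exact pullback_neg_extDeriv (differentiable_liouvilleTheta _) hs

lemma pullback_omegaLbar {w : torsionSpace} (hg : (gMat (embPf w).2.1).det ≠ 0) :
    pullback (xi ∘ embPf) omegaLbar w =
      -extDeriv (pullback (xi ∘ embPf) (poincareCartanTheta lagBar)) w :=
  pullback_neg_extDeriv
    (differentiableAt_poincareCartanTheta
      ((contDiffAt_extLegendre_lagBar (n := 1) (j := (xi ∘ embPf) w) hg).differentiableAt
        (by simp)))
    ((contDiffAt_xi (n := 2) _).comp w (contDiffAt_embPf w))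

end EinsteinPalatini

end

theorem mainTheorem9 (U : Set EinsteinPalatini.Base) (hU : IsOpen U)
    (w : EinsteinPalatini.torsionSpace) (hw : w ∈ EinsteinPalatini.finalP U) :
    EinsteinPalatini.pullback EinsteinPalatini.embPf (EinsteinPalatini.omegaH U) w =
        EinsteinPalatini.pullback (EinsteinPalatini.xi ∘ EinsteinPalatini.embPf)
          EinsteinPalatini.omegaLbar w ∧
      EinsteinPalatini.pullback (EinsteinPalatini.xi ∘ EinsteinPalatini.embPf)
          EinsteinPalatini.omegaLbar w =
        EinsteinPalatini.pullback
          (EinsteinPalatini.legendre EinsteinPalatini.lagBar ∘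
            EinsteinPalatini.xi ∘ EinsteinPalatini.embPf)
          (EinsteinPalatini.omegaHbar U) w := by
  have hg : (EinsteinPalatini.gMat (EinsteinPalatini.embPf w).2.1).det ≠ 0 :=
    EinsteinPalatini.IsLorentz.det_ne_zero hw.2
  refine ⟨?_, ?_⟩
  · rw [EinsteinPalatini.pullback_omegaH hU hw, EinsteinPalatini.pullback_omegaLbar hg,
      EinsteinPalatini.extDeriv_pullback_theta hg]
  · refine (EinsteinPalatini.pullback_omegaHbar hU ?_ hw).symm
    exact ((EinsteinPalatini.contDiffAt_xi (n := 1) _).comp w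
      (EinsteinPalatini.contDiffAt_embPf w)).differentiableAt (by simp)
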